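/- Fix an inverse temperature $\beta>0$. An \emph{object} $p=(\rho,H)$ is a density matrix $\rho$ and a Hermitian matrix $H$ (the Hamiltonian, understood up to adding real multiples of $\mathbb 1$) on a finite-dimensional Hilbert space of dimension $d(p)\ge 1$. Put $p\otimes q=(\rho\otimes\sigma,\,H\otimes\mathbb 1+\mathbb 1\otimes K)$ for $q=(\sigma,K)$, and let $\emptyset=(1,0)$ on $\mathbb C$. \emph{Thermal operations} are the finite compositions of: $(\rho,H)\mapsto(U\rho U^\dagger,UHU^\dagger)$ with $U$ unitary (possibly onto another Hilbert space of the same dimension); $p\mapsto p\otimes(\omega_K,K)$ with a Gibbs state $\omega_K=e^{-\beta K}/\mathrm{Tr}\,e^{-\beta K}$; $(\rho,H)\mapsto(U\rho U^\dagger,H)$ with $U$ unitary and $[U,H]=0$; and $(\rho_{AB},H_A\otimes\mathbb 1+\mathbb 1\otimes H_B)\mapsto(\mathrm{Tr}_B\,\rho_{AB},H_A)$. Write $r\in\mathcal F_C(p)$ if for some object $c$ (a catalyst) $p\otimes c$ can be mapped to $r\otimes c$ by a thermal operation. Let $\mathcal P$ be the set of all objects with trivial Hamiltonian ($H\in\mathbb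 R\,\mathbb 1$). A \emph{work quantifier} is a function $\mathcal W:\mathcal P\times\mathcal P\to\mathbb R$, written $\mathcal W(p\to q)$. For arbitrary objects $p_M,q_M$ let $$W^{\rm corr}_{\rm trans}(p_M\to q_M)=\sup\ \mathcal W(p_A\to q_A)\in[-\infty,\infty],$$ the supremum over all $p_A,q_A\in\mathcal P$ for which some non-interacting, possibly correlated object $r_{MA}$ with marginals $q_M$ and $q_A$ satisfies $r_{MA}\in\mathcal F_C(p_M\otimes p_A)$ ($\sup\emptyset=-\infty$). Consider the axioms: Axiom 1: $\sum_{i=1}^{n-1}\mathcal W(p^{(i)}\to p^{(i+1)})\ge 0$ for every cyclic sequence $p^{(1)},\dots,p^{(n)}=p^{(1)}$ in $\mathcal P$. Axiom 3: $\sum_{i=1}^{n-1}W^{\rm corr}_{\rm trans}(p_M^{(i)}\to p_M^{(i+1)})\le 0$ for every cyclic sequence $p_M^{(1)},\dots,p_M^{(n)}=p_M^{(1)}$ of arbitrary objects (a sum with a term $-\infty$ being $-\infty$). Let $S(\rho)=-\mathrm{Tr}(\rho\log\rho)$, $F(\rho,H)=\mathrm{Tr}(\rho H)-S(\rho)/\beta$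 and $\Delta F(\rho,H)=F(\rho,H)-F(\omega_H,H)$ (the von Neumann free energy). Theorem. A work quantifier $\mathcal W$ satisfies Axioms 1 and 3 and is of the form $\mathcal W(p\to q)=M(q)-M(p)$ for a function $M:\mathcal P\to\mathbb R$ with $M(\emptyset)=0$ that is continuous in the state for each fixed Hilbert space and Hamiltonian if and only if there is a constant $a\ge 0$ such that $$\mathcal W(p\to q)=a\,\bigl(\Delta F(q)-\Delta F(p)\bigr)\qquad\text{for all }p,q\in\mathcal P$$ ($a>0$ unless $\mathcal W$ vanishes identically). Moreover, every such $M$ is of the form $M(p)=a'\,(\log d(p)-S(\rho))$ for all $p=(\rho,H)\in\mathcal P$, with a constant $a'\ge 0$; and $\Delta F(p)=(\log d(p)-S(\rho))/\beta$ for every $p=(\rho,H)\in\mathcal P$. -/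

import Mathlib

open scoped Kronecker Matrix ComplexOrder

/-- A state (density matrix) of the finite-dimensional quantum system with Hilbert space `ℂ^ι`:
a positive semidefinite matrix of trace one.  (There is none if `ι` is empty.) -/
structure DensityMatrix (ι : Type) [Fintype ι] where
  mat : Matrix ι ι ℂ
  posSemidef : mat.PosSemidef
  trace_eq_one : mat.trace = 1

/-- States of a fixed system carry the topology of entrywise convergence. -/
noncomputable instance (ι : Type) [Fintype ι] : TopologicalSpace (DensityMatrix ι) :=
  TopologicalSpace.induced DensityMatrix.mat inferInstance

/-- A Hamiltonian of the system with Hilbert space `ℂ^ι`: a Hermitian matrix. -/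
structure Hamiltonian (ι : Type) where
  mat : Matrix ι ι ℂ
  isHermitian : mat.IsHermitian

namespace DensityMatrix

variable {ι κ : Type} [Fintype ι] [Fintype κ]

theorem nonempty_index (ρ : DensityMatrix ι) : Nonempty ι := by
  by_contra h
  rw [not_nonempty_iff] at h
  have := ρ.trace_eq_one
  simp [Matrix.trace] at this

/-- The product state `ρ ⊗ σ`. -/
def tensor (ρ : DensityMatrix ι) (σ : DensityMatrix κ) : DensityMatrix (ι × κ) :=
  ⟨ρ.mat ⊗ₖ σ.mat, by
    classical exact ρ.posSemidef.kronecker σ.posSemidef, by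
    rw [Matrix.trace_kronecker, ρ.trace_eq_one, σ.trace_eq_one, one_mul]⟩

/-- The state `U ρ U†`, for a unitary `U` from `ℂ^ι` onto `ℂ^κ`. -/
def conj [DecidableEq ι] (U : Matrix κ ι ℂ) (hU : Uᴴ * U = 1) (ρ : DensityMatrix ι) :
    DensityMatrix κ :=
  ⟨U * ρ.mat * Uᴴ, ρ.posSemidef.mul_mul_conjTranspose_same U, by
    rw [Matrix.trace_mul_comm, ← Matrix.mul_assoc, hU, Matrix.one_mul, ρ.trace_eq_one]⟩

/-- The reduced state on the first factor: the partial trace over the second factor. -/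
def marginalLeft (ρ : DensityMatrix (ι × κ)) : DensityMatrix ι :=
  ⟨Matrix.of fun i j => ∑ k, ρ.mat (i, k) (j, k), by
    have h : (Matrix.of fun i j => ∑ k, ρ.mat (i, k) (j, k))
        = ∑ k, ρ.mat.submatrix (fun i : ι => (i, k)) (fun i : ι => (i, k)) := by
      ext i j
      simp [Matrix.sum_apply]
    rw [h]
    exact Matrix.posSemidef_sum _ fun k _ => ρ.posSemidef.submatrix _, by
    rw [← ρ.trace_eq_one]
    simp [Matrix.trace, Fintype.sum_prod_type]⟩

/-- The reduced state on the second factor: the partial trace over the first factor. -/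
def marginalRight (ρ : DensityMatrix (ι × κ)) : DensityMatrix κ :=
  ⟨Matrix.of fun i j => ∑ k, ρ.mat (k, i) (k, j), by
    have h : (Matrix.of fun i j => ∑ k, ρ.mat (k, i) (k, j))
        = ∑ k, ρ.mat.submatrix (fun i : κ => (k, i)) (fun i : κ => (k, i)) := by
      ext i j
      simp [Matrix.sum_apply]
    rw [h]
    exact Matrix.posSemidef_sum _ fun k _ => ρ.posSemidef.submatrix _, by
    rw [← ρ.trace_eq_one]
    simp [Matrix.trace, Fintype.sum_prod_type_right]⟩

/-- The von Neumann entropy `S(ρ) = - Tr (ρ log ρ)` (natural logarithm), computed from the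
eigenvalues, with `0 log 0 = 0`. -/
noncomputable def entropy [DecidableEq ι] (ρ : DensityMatrix ι) : ℝ :=
  ∑ i, Real.negMulLog (ρ.posSemidef.isHermitian.eigenvalues i)

end DensityMatrix

namespace Hamiltonian

variable {ι κ : Type}

/-- The Hamiltonian `H ⊗ 1 + 1 ⊗ K` of a non-interacting bipartite system. -/
def nonInteracting [DecidableEq ι] [DecidableEq κ] (H : Hamiltonian ι) (K : Hamiltonian κ) :
    Hamiltonian (ι × κ) :=
  ⟨H.mat ⊗ₖ (1 : Matrix κ κ ℂ) + (1 : Matrix ι ι ℂ) ⊗ₖ K.mat, by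
    refine Matrix.IsHermitian.add ?_ ?_
    · rw [Matrix.IsHermitian, Matrix.conjTranspose_kronecker, H.isHermitian,
        Matrix.conjTranspose_one]
    · rw [Matrix.IsHermitian, Matrix.conjTranspose_kronecker, K.isHermitian,
        Matrix.conjTranspose_one]⟩

/-- The Hamiltonian `U H U†`. -/
def conj [Fintype ι] (U : Matrix κ ι ℂ) (H : Hamiltonian ι) : Hamiltonian κ :=
  ⟨U * H.mat * Uᴴ, Matrix.isHermitian_mul_mul_conjTranspose U H.isHermitian⟩

/-- The Hamiltonian `H + c 1`. -/
def shift [DecidableEq ι] (c : ℝ) (H : Hamiltonian ι) : Hamiltonian ι :=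
  ⟨H.mat + (c : ℂ) • (1 : Matrix ι ι ℂ), by
    refine H.isHermitian.add ?_
    rw [Matrix.IsHermitian, Matrix.conjTranspose_smul, Matrix.conjTranspose_one]
    simp⟩

/-- The unnormalised Gibbs operator `exp (-β H)`. -/
noncomputable def boltzmann [Fintype ι] [DecidableEq ι] (β : ℝ) (H : Hamiltonian ι) :
    Matrix ι ι ℂ :=
  NormedSpace.exp ((-β : ℂ) • H.mat)

theorem posDef_boltzmann [Fintype ι] [DecidableEq ι] (β : ℝ) (H : Hamiltonian ι) :
    (H.boltzmann β).PosDef := by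
  have hA : ((-β / 2 : ℂ) • H.mat).IsHermitian := by
    rw [Matrix.IsHermitian, Matrix.conjTranspose_smul, H.isHermitian]
    simp
  have h : H.boltzmann β
      = (NormedSpace.exp ((-β / 2 : ℂ) • H.mat))ᴴ * NormedSpace.exp ((-β / 2 : ℂ) • H.mat) := by
    rw [hA.exp, ← Matrix.exp_add_of_commute _ _ (Commute.refl _), ← add_smul, add_halves,
      boltzmann]
  rw [h]
  refine Matrix.PosDef.conjTranspose_mul_self _ ?_
  exact Matrix.mulVec_injective_of_isUnit (Matrix.isUnit_exp _)

/-- The Gibbs state `exp (-β H) / Tr (exp (-β H))`. -/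
noncomputable def gibbs [Fintype ι] [DecidableEq ι] [Nonempty ι] (β : ℝ) (H : Hamiltonian ι) :
    DensityMatrix ι :=
  ⟨((H.boltzmann β).trace)⁻¹ • H.boltzmann β,
    (H.posDef_boltzmann β).posSemidef.smul
      (inv_nonneg.2 (H.posDef_boltzmann β).posSemidef.trace_nonneg), by
    have h := (H.posDef_boltzmann β).trace_pos
    rw [Matrix.trace_smul, smul_eq_mul]
    exact inv_mul_cancel₀ (ne_of_gt h)⟩

end Hamiltonian

/-- An object `p = (ρ, H)`: a state and a Hamiltonian of a finite-dimensional quantum system.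
`H` is a representative of the physical Hamiltonian, which is defined up to a multiple of `1`. -/
structure QObject : Type 1 where
  ι : Type
  [fintype : Fintype ι]
  [decEq : DecidableEq ι]
  state : DensityMatrix ι
  ham : Hamiltonian ι

attribute [instance] QObject.fintype QObject.decEq

namespace QObject

instance (p : QObject) : Nonempty p.ι := p.state.nonempty_index

/-- The dimension of the Hilbert space of an object. -/
def dim (p : QObject) : ℕ := Fintype.card p.ι

/-- `p ⊗ q = (ρ ⊗ σ, H ⊗ 1 + 1 ⊗ K)`. -/
def tensor (p q : QObject) : QObject :=
  ⟨p.ι × q.ι, p.state.tensor q.state, p.ham.nonInteracting q.ham⟩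

/-- The empty object: the state `1` with Hamiltonian `0` on the Hilbert space `ℂ`. -/
def empty : QObject :=
  ⟨Unit, ⟨1, Matrix.PosSemidef.one, by simp⟩, ⟨0, Matrix.isHermitian_zero⟩⟩

/-- The von Neumann entropy of the state of an object. -/
noncomputable def entropy (p : QObject) : ℝ := p.state.entropy

/-- `F (ρ, H) = Tr (ρ H) - S(ρ) / β`. -/
noncomputable def freeEnergy (β : ℝ) (p : QObject) : ℝ :=
  (p.state.mat * p.ham.mat).trace.re - p.entropy / β

/-- The Gibbs object with the Hamiltonian of `p`. -/
noncomputable def gibbs (β : ℝ) (p : QObject) : QObject := ⟨p.ι, p.ham.gibbs β, p.ham⟩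

/-- The von Neumann free energy `ΔF (ρ, H) = F (ρ, H) - F (ω_H, H)`, with `ω_H` the Gibbs
state. -/
noncomputable def deltaF (β : ℝ) (p : QObject) : ℝ := p.freeEnergy β - (p.gibbs β).freeEnergy β

end QObject

/-- `ThermalTransition β p q`: the object `q` can be reached from `p` by a thermal operation at
inverse temperature `β`.  Thermal operations are the finite compositions of: changing the
Hilbert-space frame by a unitary (which acts on state and Hamiltonian), adding a heat bath in
its Gibbs state, applying a unitary to the state that commutes with the Hamiltonian, and tracing
out one part of a non-interacting (possibly correlated) bipartite object.  Hamiltonians that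
differ by a multiple of `1` represent the same physical Hamiltonian, whence `shift`. -/
inductive ThermalTransition (β : ℝ) : QObject → QObject → Prop
  | conj {ι κ : Type} [Fintype ι] [DecidableEq ι] [Fintype κ] [DecidableEq κ]
      (U : Matrix κ ι ℂ) (hU : Uᴴ * U = 1) (_hU' : U * Uᴴ = 1)
      (ρ : DensityMatrix ι) (H : Hamiltonian ι) :
      ThermalTransition β ⟨ι, ρ, H⟩ ⟨κ, ρ.conj U hU, H.conj U⟩
  | shift {ι : Type} [Fintype ι] [DecidableEq ι] (c : ℝ)
      (ρ : DensityMatrix ι) (H : Hamiltonian ι) :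
      ThermalTransition β ⟨ι, ρ, H⟩ ⟨ι, ρ, H.shift c⟩
  | addBath (p : QObject) {κ : Type} [Fintype κ] [DecidableEq κ] [Nonempty κ]
      (H : Hamiltonian κ) :
      ThermalTransition β p (p.tensor ⟨κ, H.gibbs β, H⟩)
  | energyPreserving {ι : Type} [Fintype ι] [DecidableEq ι]
      (U : Matrix ι ι ℂ) (hU : Uᴴ * U = 1)
      (ρ : DensityMatrix ι) (H : Hamiltonian ι) (_hcomm : Commute U H.mat) :
      ThermalTransition β ⟨ι, ρ, H⟩ ⟨ι, ρ.conj U hU, H⟩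
  | traceOut {ι κ : Type} [Fintype ι] [DecidableEq ι] [Fintype κ] [DecidableEq κ]
      (ρ : DensityMatrix (ι × κ)) (H : Hamiltonian ι) (K : Hamiltonian κ) :
      ThermalTransition β ⟨ι × κ, ρ, H.nonInteracting K⟩ ⟨ι, ρ.marginalLeft, H⟩
  | trans {p q r : QObject} :
      ThermalTransition β p q → ThermalTransition β q r → ThermalTransition β p r

/-- `r ∈ F_C(p)`: with the help of a catalyst `q`, which is returned unchanged and
uncorrelated, `r` can be reached from `p` by a thermal operation. -/
def CatalyticTransition (β : ℝ) (p r : QObject) : Prop :=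
  ∃ q : QObject, ThermalTransition β (p.tensor q) (r.tensor q)

/-- Starting from the uncorrelated fuel `pM` and work-storage device `pA`, a catalytic free
transition can reach a non-interacting, possibly correlated object whose marginals are the fuel
`qM` and the work-storage device `qA`. -/
def CorrelatedReach (β : ℝ) (pM pA qM qA : QObject) : Prop :=
  ∃ ρ : DensityMatrix (qM.ι × qA.ι),
    ρ.marginalLeft = qM.state ∧ ρ.marginalRight = qA.state ∧
    CatalyticTransition β (pM.tensor pA) ⟨qM.ι × qA.ι, ρ, qM.ham.nonInteracting qA.ham⟩

/-- The correlated work of transition of the fuel: the supremum in `[-∞, ∞]` of the work values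
of the transitions of the work-storage device, within the allowed set `P`, that can accompany the
transition `pM → qM` of the fuel (`-∞` if there are none). -/
noncomputable def corrWork (β : ℝ) (P : Set QObject) (W : P → P → ℝ) (pM qM : QObject) : EReal :=
  ⨆ (pA : P) (qA : P) (_ : CorrelatedReach β pM pA qM qA), (W pA qA : EReal)

/-- Cyclic transitions of the work-storage device: along every cyclic sequence in `P` the total
work value is nonnegative. -/
def CyclicDeviceAxiom (P : Set QObject) (W : P → P → ℝ) : Prop :=
  ∀ (n : ℕ) (p : ℕ → P), p n = p 0 → 0 ≤ ∑ i ∈ Finset.range n, W (p i) (p (i + 1))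

/-- Correlated cyclic transitions of the fuel: along every cyclic sequence of arbitrary objects
the total correlated work of transition is nonpositive.  (In `EReal` a sum with a term `-∞` is
`-∞`: a cycle with an impossible step imposes no condition.) -/
def CorrelatedCyclicFuelAxiom (β : ℝ) (P : Set QObject) (W : P → P → ℝ) : Prop :=
  ∀ (n : ℕ) (p : ℕ → QObject), p n = p 0 →
    ∑ i ∈ Finset.range n, corrWork β P W (p i) (p (i + 1)) ≤ 0

/-- Continuity in the state, for each fixed Hilbert space and Hamiltonian. -/
def ContinuousInState (P : Set QObject) (M : P → ℝ) : Prop :=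
  ∀ (ι : Type) [Fintype ι] [DecidableEq ι] (H : Hamiltonian ι),
    Continuous fun ρ : {ρ : DensityMatrix ι // (⟨ι, ρ, H⟩ : QObject) ∈ P} =>
      M ⟨⟨ι, ρ.1, H⟩, ρ.2⟩

/-- All finite-dimensional states with trivial Hamiltonian: a real multiple of the identity. -/
def trivialHamiltonian : Set QObject :=
  {p | ∃ c : ℝ, p.ham.mat = (c : ℂ) • (1 : Matrix p.ι p.ι ℂ)}

theorem empty_mem_trivialHamiltonian : QObject.empty ∈ trivialHamiltonian :=
  ⟨0, by
    rw [Complex.ofReal_zero, zero_smul]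
    rfl⟩

/-- The empty object, as a work-storage device with trivial Hamiltonian. -/
def emptyDevice : trivialHamiltonian := ⟨QObject.empty, empty_mem_trivialHamiltonian⟩

/-- `M` is a continuous state function with `M ∅ = 0` whose differences are the work values. -/
def IsContinuousPotential (W : trivialHamiltonian → trivialHamiltonian → ℝ)
    (M : trivialHamiltonian → ℝ) : Prop :=
  M emptyDevice = 0 ∧ ContinuousInState trivialHamiltonian M ∧ ∀ p q, W p q = M q - M p

/-!
# Correlated work quantifiers on devices with trivial Hamiltonian

The free energy difference `ΔF` is additive on uncorrelated objects, superadditive on correlated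
ones, and does not increase under thermal operations. All of this comes from one inequality, the
Gibbs variational principle `S(ρ) ≤ Tr (ρ X) + log Tr exp (-X)`
(`DensityMatrix.entropy_le_trace_add_log`): it gives `0 ≤ ΔF`, and, applied to an observable
`X ⊗ 1 + 1 ⊗ Y`, subadditivity of the entropy (`DensityMatrix.entropy_le_marginals`). Hence a
correlated catalytic transition satisfies `ΔF(q_M) + ΔF(q_A) ≤ ΔF(p_M) + ΔF(p_A)`
(`CorrelatedReach.deltaF_le`), so for `W = a (ΔF(q) - ΔF(p))` the correlated work of transition is
at most `a (ΔF(p_M) - ΔF(q_M))`, which telescopes to zero along a cycle.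

Conversely, let `M` be a continuous potential. Since devices may serve as fuel, two-step fuel cycles
through the empty object turn the axiom into properties of `M`: exchanging a product part of the
device with the fuel shows that `M` is subadditive on products, and moving a correlated part of the
device to the fuel and returning it without its correlations shows that `M` is superadditive; fuel
cycles of length one show that `M` decreases under thermal operations. In particular `M` depends
only on the spectrum of the state, and restricts to a function of finite probability distributions
that is nonnegative, additive, superadditive, symmetric, continuous and zero on uniform
distributions (`IsContinuousPotential.isNonuniformity`).

Such a function `m` equals `a (log d - S)`, with `a log 2 = m(pure bit)`, by a two-sided asymptotic
argument.

* Distillation (`IsNonuniformity.mul_le`): almost all weight of `p^n` is carried by about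
  `exp (n S)` sequences. After adding noise, a permutation of the outcomes moves these into the part
  of the sample space where about `n (log d - S) / log 2` bits vanish. By superadditivity and
  continuity these nearly pure bits are jointly worth about `n a (log d - S)`.
* Formation (`IsNonuniformity.le_mul`): the uniform distribution on a permutation-invariant set of
  about `exp (n S)` typical sequences can be created from about `n (log d - S) / log 2` pure bits.
  Its marginals all coincide and are close to `p`, so superadditivity and continuity bound `n m(p)`
  by the value of these bits.
-/

/-! ### Finite probability distributions -/

namespace stdSimplex

open Finset

variable {α γ : Type*} [Fintype α] [Fintype γ]

theorem map_apply [DecidableEq γ] (f : α → γ) (r : stdSimplex ℝ α) (y : γ) :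
    map f r y = ∑ x with f x = y, r x := by
  simp only [map_coe, FunOnFinite.linearMap_apply_apply]

/-- Expectations transform under push-forward. -/
theorem sum_map_mul (f : α → γ) (r : stdSimplex ℝ α) (g : γ → ℝ) :
    ∑ y, map f r y * g y = ∑ x, r x * g (f x) := by
  classical
  simp only [map_apply, Finset.sum_mul]
  rw [← Finset.sum_fiberwise univ f]
  refine Finset.sum_congr rfl fun y _ => Finset.sum_congr rfl fun x hx => ?_
  rw [(mem_filter.1 hx).2]

theorem map_equiv_apply (e : α ≃ γ) (r : stdSimplex ℝ α) (y : γ) :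
    map e r y = r (e.symm y) := by
  classical
  rw [map_apply, Finset.sum_eq_single (e.symm y)]
  · intro x hx h
    exact absurd ((Equiv.eq_symm_apply e).2 (mem_filter.1 hx).2) h
  · simp

theorem map_eq_of_injective {f : α → γ} (hf : f.Injective) (r : stdSimplex ℝ α) (x : α) :
    map f r (f x) = r x := by
  classical
  rw [map_apply, Finset.sum_eq_single x]
  · intro z hz h
    exact absurd (hf (mem_filter.1 hz).2) h
  · simp

/-- The product distribution. -/
def prod (p : stdSimplex ℝ α) (q : stdSimplex ℝ γ) : stdSimplex ℝ (α × γ) :=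
  ⟨fun x => p x.1 * q x.2, fun x => mul_nonneg (zero_le p _) (zero_le q _), by
    simp [Fintype.sum_prod_type, ← Finset.mul_sum]⟩

theorem prod_apply (p : stdSimplex ℝ α) (q : stdSimplex ℝ γ) (x : α × γ) :
    prod p q x = p x.1 * q x.2 := rfl

/-- The distribution of `n` independent samples of `p`. -/
def iid (p : stdSimplex ℝ α) (n : ℕ) : stdSimplex ℝ (Fin n → α) :=
  ⟨fun x => ∏ j, p (x j), fun x => Finset.prod_nonneg fun _ _ => zero_le p _, by
    rw [← Fintype.sum_pow, sum_eq_one p, one_pow]⟩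

theorem iid_apply (p : stdSimplex ℝ α) (n : ℕ) (x : Fin n → α) :
    iid p n x = ∏ j, p (x j) := rfl

/-- The uniform distribution on a nonempty finite set. -/
noncomputable def uniformOn [DecidableEq α] (s : Finset α) (hs : s.Nonempty) : stdSimplex ℝ α :=
  ⟨fun x => if x ∈ s then (#s : ℝ)⁻¹ else 0, fun x => by positivity, by
    have : (#s : ℝ) ≠ 0 := by exact_mod_cast hs.card_pos.ne'
    simp [this]⟩

theorem uniformOn_apply [DecidableEq α] (s : Finset α) (hs : s.Nonempty) (x : α) :
    uniformOn s hs x = if x ∈ s then (#s : ℝ)⁻¹ else 0 := rfl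

theorem coe_barycenter_apply [Nonempty α] (x : α) :
    (barycenter : stdSimplex ℝ α) x = (Fintype.card α : ℝ)⁻¹ := rfl

/-- Chernoff bound: if `g` has negative mean, then the probability that a sum of `n` independent
samples of `g` is nonnegative decays exponentially. -/
theorem exists_chernoff (p : stdSimplex ℝ α) (g : α → ℝ) (hg : ∑ i, p i * g i < 0) :
    ∃ θ : ℝ, 0 ≤ θ ∧ θ < 1 ∧
      ∀ n : ℕ, ∑ x : Fin n → α with 0 ≤ ∑ j, g (x j), iid p n x ≤ θ ^ n := by
  have hd : HasDerivAt (fun s : ℝ => ∑ i, p i * Real.exp (s * g i)) (∑ i, p i * g i) 0 := by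
    refine HasDerivAt.fun_sum fun i _ => ?_
    have h := ((hasDerivAt_id (0 : ℝ)).mul_const (g i)).exp.const_mul (p i)
    simpa using h
  -- The moment generating function starts at `1` with negative slope.
  obtain ⟨s, hs, hs0⟩ : ∃ s : ℝ, ∑ i, p i * Real.exp (s * g i) < 1 ∧ 0 < s := by
    rw [hasDerivAt_iff_tendsto_slope_zero] at hd
    have h1 := (hd.eventually (gt_mem_nhds hg)).filter_mono
      (nhdsWithin_mono 0 (fun x (hx : x ∈ Set.Ioi 0) => ne_of_gt hx))
    obtain ⟨s, h, hs⟩ := (h1.and self_mem_nhdsWithin).exists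
    have hs : 0 < s := hs
    refine ⟨s, ?_, hs⟩
    simp only [zero_add, zero_mul, Real.exp_zero, mul_one, sum_eq_one, smul_eq_mul] at h
    have := (pos_iff_neg_of_mul_neg h).1 (inv_pos.2 hs)
    linarith
  refine ⟨_, Finset.sum_nonneg fun i _ => mul_nonneg (zero_le p i) (Real.exp_pos _).le, hs,
    fun n => ?_⟩
  rw [Fintype.sum_pow]
  refine le_trans ?_ (Finset.sum_le_sum_of_subset_of_nonneg
    (Finset.filter_subset (fun x : Fin n → α => 0 ≤ ∑ j, g (x j)) univ)
    fun x _ _ => Finset.prod_nonneg fun j _ => mul_nonneg (zero_le p _) (Real.exp_pos _).le)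
  refine Finset.sum_le_sum fun x hx => ?_
  rw [Finset.prod_mul_distrib, ← Real.exp_sum, ← Finset.mul_sum, iid_apply]
  refine le_mul_of_one_le_right (Finset.prod_nonneg fun _ _ => zero_le p _) ?_
  exact Real.one_le_exp (mul_nonneg hs0.le (mem_filter.1 hx).2)

/-- Weak law of large numbers: finitely many sample sums with negative means are simultaneously
negative with probability tending to one. -/
theorem eventually_prob_lt (p : stdSimplex ℝ α) {τ : Type*} [Fintype τ] (g : τ → α → ℝ)
    (hg : ∀ k, ∑ i, p i * g k i < 0) {ε : ℝ} (hε : 0 < ε) :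
    ∀ᶠ n : ℕ in Filter.atTop,
      1 - ε < ∑ x : Fin n → α with ∀ k, ∑ j, g k (x j) < 0, iid p n x := by
  classical
  choose θ h0 h1 h2 using fun k => exists_chernoff p (g k) (hg k)
  have hlim : Filter.Tendsto (fun n : ℕ => ∑ k, θ k ^ n) Filter.atTop (nhds 0) := by
    rw [show (0 : ℝ) = ∑ _k : τ, 0 by simp]
    exact tendsto_finsetSum _ fun k _ => tendsto_pow_atTop_nhds_zero_of_lt_one (h0 k) (h1 k)
  filter_upwards [hlim.eventually (gt_mem_nhds hε)] with n hn
  have hsplit := Finset.sum_filter_add_sum_filter_not univ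
    (fun x : Fin n → α => ∀ k, ∑ j, g k (x j) < 0) (iid p n)
  rw [sum_eq_one] at hsplit
  have hbad : ∑ x : Fin n → α with ¬ ∀ k, ∑ j, g k (x j) < 0, iid p n x ≤ ∑ k, θ k ^ n := by
    refine le_trans ?_ (Finset.sum_le_sum fun k _ => h2 k n)
    simp only [Finset.sum_filter]
    rw [Finset.sum_comm]
    refine Finset.sum_le_sum fun x _ => ?_
    have hnn : ∀ k ∈ univ, 0 ≤ if 0 ≤ ∑ j, g k (x j) then iid p n x else 0 := fun k _ => by
      split_ifs
      exacts [zero_le _ x, le_rfl]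
    split_ifs with h
    · exact Finset.sum_nonneg hnn
    · push Not at h
      obtain ⟨k, hk⟩ := h
      exact le_trans (by rw [if_pos hk]) (Finset.single_le_sum hnn (mem_univ k))
  linarith

end stdSimplex

/-! ### Two elementary limits and an extension of injections -/

/-- A partial injection between types of equal size extends to a bijection. -/
theorem Equiv.exists_extend_of_injOn {α γ : Type*} [Fintype α] [Fintype γ]
    (h : Fintype.card α = Fintype.card γ) (s : Finset α) (f : α → γ) (hf : Set.InjOn f s) :
    ∃ e : α ≃ γ, ∀ a ∈ s, e a = f a := by
  classical
  obtain ⟨g, hg⟩ := Finset.exists_equiv_extend_of_card_eq (t := (Finset.univ : Finset γ))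
    (by simpa using h) (s := s) (f := f) (by simp) hf
  exact ⟨g.trans (Equiv.subtypeUnivEquiv (by simp)), fun a ha => hg a ha⟩

theorem le_of_forall_small {x y δ₀ K : ℝ} (hδ₀ : 0 < δ₀)
    (h : ∀ δ, 0 < δ → δ < δ₀ → x - δ * K ≤ y) : x ≤ y := by
  have hlim : Filter.Tendsto (fun δ : ℝ => x - δ * K) (nhdsWithin 0 (Set.Ioi 0)) (nhds x) := by
    have : Continuous fun δ : ℝ => x - δ * K := by fun_prop
    simpa using (this.tendsto 0).mono_left nhdsWithin_le_nhds
  refine le_of_tendsto hlim ?_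
  filter_upwards [Ioo_mem_nhdsGT hδ₀] with δ hδ using h δ hδ.1 hδ.2

theorem le_of_eventually_mul_sub_le {x y C : ℝ}
    (h : ∀ᶠ n : ℕ in Filter.atTop, n * x - C ≤ n * y) : x ≤ y := by
  have hlim : Filter.Tendsto (fun n : ℕ => x - C / n) Filter.atTop (nhds x) := by
    simpa using (tendsto_const_div_atTop_nhds_zero_nat C).const_sub x
  refine le_of_tendsto hlim ?_
  filter_upwards [h, Filter.eventually_gt_atTop 0] with n hn h0
  have h0 : (0 : ℝ) < n := by exact_mod_cast h0
  have : x - C / n = (n * x - C) / n := by field_simp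
  rw [this, div_le_iff₀ h0]
  linarith

/-! ### Additive and superadditive measures of nonuniformity -/

/-- A measure of nonuniformity: a family of functions on the finite probability simplices that is
nonnegative, invariant under relabelling of the outcomes, additive on independent pairs,
superadditive on correlated pairs, zero on uniform distributions, and continuous. -/
structure IsNonuniformity (m : (ι : Type) → [Fintype ι] → stdSimplex ℝ ι → ℝ) : Prop where
  nonneg {ι : Type} [Fintype ι] (p : stdSimplex ℝ ι) : 0 ≤ m ι p
  map_equiv {ι κ : Type} [Fintype ι] [Fintype κ] (e : ι ≃ κ) (p : stdSimplex ℝ ι) :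
    m κ (stdSimplex.map e p) = m ι p
  prod {ι κ : Type} [Fintype ι] [Fintype κ] (p : stdSimplex ℝ ι) (q : stdSimplex ℝ κ) :
    m (ι × κ) (stdSimplex.prod p q) = m ι p + m κ q
  superadditive {ι κ : Type} [Fintype ι] [Fintype κ] (r : stdSimplex ℝ (ι × κ)) :
    m ι (stdSimplex.map Prod.fst r) + m κ (stdSimplex.map Prod.snd r) ≤ m (ι × κ) r
  uniform {ι : Type} [Fintype ι] [Nonempty ι] : m ι stdSimplex.barycenter = 0
  continuous (ι : Type) [Fintype ι] : Continuous (m ι)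

namespace IsNonuniformity

open Finset stdSimplex

variable {m : (ι : Type) → [Fintype ι] → stdSimplex ℝ ι → ℝ}
  {ι κ τ : Type} [Fintype ι] [Fintype κ] [Fintype τ]

theorem iid (hm : IsNonuniformity m) (p : stdSimplex ℝ ι) (n : ℕ) :
    m (Fin n → ι) (stdSimplex.iid p n) = n * m ι p := by
  induction n with
  | zero =>
    have : stdSimplex.iid p 0 = barycenter := Subsingleton.elim _ _
    simp [this, hm.uniform]
  | succ n ih =>
    have : stdSimplex.iid p (n + 1)
        = map (Fin.consEquiv fun _ => ι) (stdSimplex.prod p (stdSimplex.iid p n)) := by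
      apply stdSimplex.ext
      funext x
      rw [map_equiv_apply, iid_apply, Fin.prod_univ_succ]
      rfl
    rw [this, hm.map_equiv, hm.prod, ih]
    push_cast
    ring

/-- Superadditivity over `n` correlated parts. -/
theorem sum_marginals_le (hm : IsNonuniformity m) {n : ℕ} (r : stdSimplex ℝ (Fin n → ι)) :
    ∑ j, m ι (map (fun x => x j) r) ≤ m (Fin n → ι) r := by
  induction n with
  | zero => simpa using hm.nonneg r
  | succ n ih =>
    have h1 := hm.superadditive (map (Fin.consEquiv fun _ => ι).symm r)
    rw [hm.map_equiv, map_comp_apply, map_comp_apply] at h1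
    have h2 := ih (map (Prod.snd ∘ (Fin.consEquiv fun _ => ι).symm) r)
    simp only [map_comp_apply] at h2
    rw [Fin.sum_univ_succ]
    exact le_trans (add_le_add le_rfl h2) h1

/-- Relabelling the outcomes and forgetting a part of them does not increase nonuniformity. -/
theorem map_fst_le (hm : IsNonuniformity m) (e : ι ≃ κ × τ) (r : stdSimplex ℝ ι) :
    m κ (map (fun a => (e a).1) r) ≤ m ι r := by
  have h := hm.superadditive (map e r)
  rw [hm.map_equiv, map_comp_apply, map_comp_apply] at h
  exact le_trans (le_add_of_nonneg_right (hm.nonneg _)) h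

/-- If `A` is a small set of outcomes, then `l` bits can be extracted that all vanish whenever the
outcome lies in `A`. -/
theorem exists_bits_of_card_le (hm : IsNonuniformity m) (r : stdSimplex ℝ ι) (A : Finset ι)
    {l : ℕ} (hA : #A * 2 ^ l ≤ Fintype.card ι) :
    ∃ q : stdSimplex ℝ (Fin l → Fin 2), m _ q ≤ m ι r ∧ ∑ x ∈ A, r x ≤ q 0 := by
  classical
  obtain ⟨φ⟩ : Nonempty (A × (Fin l → Fin 2) ↪ ι) := by
    apply Function.Embedding.nonempty_of_card_le
    simpa using hA
  -- Uniform noise on `l` bits is added, and `A × {0,1}^l` is moved into `{0} × ι`.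
  obtain ⟨e, he⟩ := Equiv.exists_extend_of_injOn (α := ι × (Fin l → Fin 2))
    (γ := (Fin l → Fin 2) × ι) (by simp [mul_comm]) (A ×ˢ univ)
    (fun x => if h : x.1 ∈ A then (0, φ (⟨x.1, h⟩, x.2)) else (0, x.1)) (by
      rintro ⟨x, b⟩ hx ⟨y, c⟩ hy hxy
      have hx : x ∈ A := by simpa using hx
      have hy : y ∈ A := by simpa using hy
      simpa [hx, hy] using hxy)
  refine ⟨map (fun a => (e a).1) (stdSimplex.prod r barycenter), ?_, ?_⟩
  · refine (hm.map_fst_le e _).trans_eq ?_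
    rw [hm.prod, hm.uniform, add_zero]
  · rw [map_apply]
    have h1 : ∑ x ∈ A, r x
        = ∑ x ∈ A ×ˢ univ, stdSimplex.prod r (barycenter : stdSimplex ℝ (Fin l → Fin 2)) x := by
      simp [Finset.sum_product, stdSimplex.prod_apply, ← Finset.mul_sum]
    rw [h1]
    refine Finset.sum_le_sum_of_subset_of_nonneg (fun x hx => ?_) fun x _ _ => zero_le _ x
    have hxA : x.1 ∈ A := by simpa using hx
    simp [he x hx, hxA]

/-- Pure bits suffice to create a uniform distribution on a large set of outcomes. -/
theorem uniformOn_le (hm : IsNonuniformity m) [DecidableEq ι] (T : Finset ι) (hT : T.Nonempty)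
    {l : ℕ} (h : Fintype.card ι ≤ 2 ^ l * #T) :
    m ι (uniformOn T hT) ≤ l * m (Fin 2) (vertex 0) := by
  -- Uniform noise on `T × ι` is added; the `T`-part becomes the output, while `ι` is hidden in the
  -- pure bits and in a second copy of `T`.
  obtain ⟨φ⟩ : Nonempty (ι ↪ (Fin l → Fin 2) × T) := by
    apply Function.Embedding.nonempty_of_card_le
    simpa using h
  obtain ⟨e, he⟩ := Equiv.exists_extend_of_injOn (α := (Fin l → Fin 2) × (T × ι))
    (γ := ι × ((Fin l → Fin 2) × T)) (by simp; ring) ({0} ×ˢ univ)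
    (fun x => (x.2.1, φ x.2.2)) (by
      rintro ⟨b, t, x⟩ hx ⟨c, u, y⟩ hy hxy
      have hx : b = 0 := by simpa [eq_comm] using hx
      have hy : c = 0 := by simpa [eq_comm] using hy
      obtain ⟨h1, h2⟩ := Prod.mk.inj hxy
      exact Prod.ext (hx.trans hy.symm) (Prod.ext (Subtype.ext h1) (φ.injective h2)))
  have hTne : Nonempty T := hT.to_subtype
  have hne : Nonempty ι := ⟨hT.choose⟩
  have hpure : m (Fin l → Fin 2) (vertex 0) = l * m (Fin 2) (vertex 0) := by
    rw [← hm.iid]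
    congr 1
    apply stdSimplex.ext
    funext x
    rw [iid_apply]
    by_cases hx : x = 0
    · simp [hx]
    · obtain ⟨j, hj⟩ := Function.ne_iff.1 hx
      rw [Finset.prod_eq_zero (mem_univ j) (by simpa using Pi.single_eq_of_ne hj _)]
      simp [Pi.single_eq_of_ne hx]
  -- All bits of the source are zero, so only the values of `e` on `{0} × (T × ι)` matter.
  have hprod : stdSimplex.prod (vertex (0 : Fin l → Fin 2)) (barycenter : stdSimplex ℝ (T × ι))
      = stdSimplex.map (Prod.mk 0) barycenter := by
    apply stdSimplex.ext
    funext ⟨b, y⟩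
    by_cases hb : b = 0
    · subst hb
      rw [map_eq_of_injective (Prod.mk_right_injective _), stdSimplex.prod_apply]
      simp
    · rw [map_apply, stdSimplex.prod_apply]
      simp [hb, Ne.symm hb]
  have hmap : map (fun a => (e a).1) (map (Prod.mk 0) (barycenter : stdSimplex ℝ (T × ι)))
      = uniformOn T hT := by
    rw [map_comp_apply]
    have : ((fun a => (e a).1) ∘ Prod.mk 0) = fun x : T × ι => (x.1 : ι) := by
      funext x
      simp [he]
    rw [this]
    apply stdSimplex.ext
    funext y
    have hcard : (Fintype.card ι : ℝ) ≠ 0 := by exact_mod_cast Fintype.card_ne_zero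
    rw [map_apply, uniformOn_apply, Finset.sum_filter, Fintype.sum_prod_type]
    by_cases hy : y ∈ T
    · rw [Finset.sum_eq_single ⟨y, hy⟩]
      · simp [hy, coe_barycenter_apply, hcard]
      · intro t _ ht
        have : (t : ι) ≠ y := fun h => ht (Subtype.ext h)
        simp [this]
      · simp
    · rw [if_neg hy]
      refine Finset.sum_eq_zero fun t _ => ?_
      have : (t : ι) ≠ y := fun h => hy (h ▸ t.2)
      simp [this]
  have := hm.map_fst_le e (stdSimplex.prod (vertex (0 : Fin l → Fin 2)) barycenter)
  rwa [hm.prod, hm.uniform, add_zero, hpure, hprod, hmap] at this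

end IsNonuniformity

/-! ### Typical sequences -/

/-- The Shannon entropy (natural logarithm) of a finite probability distribution. -/
noncomputable def stdSimplex.shannon {ι : Type} [Fintype ι] (p : stdSimplex ℝ ι) : ℝ :=
  ∑ i, Real.negMulLog (p i)


namespace stdSimplex

open Finset

variable {ι : Type} [Fintype ι]

theorem sum_mul_log (p : stdSimplex ℝ ι) : ∑ i, p i * Real.log (p i) = -shannon p := by
  simp [shannon, Real.negMulLog]

theorem iid_eq_exp (p : stdSimplex ℝ ι) {n : ℕ} {x : Fin n → ι} (hx : 0 < iid p n x) :
    iid p n x = Real.exp (∑ j, Real.log (p (x j))) := by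
  rw [iid_apply] at hx ⊢
  rw [Real.exp_sum]
  refine Finset.prod_congr rfl fun j _ => (Real.exp_log ?_).symm
  refine lt_of_le_of_ne (zero_le p _) fun h => hx.ne' ?_
  exact Finset.prod_eq_zero (mem_univ j) h.symm

/-- Outcomes of probability zero may be excluded from an event. -/
theorem sum_filter_and_pos (p : stdSimplex ℝ ι) (P : ι → Prop) [DecidablePred P] :
    ∑ x with P x ∧ 0 < p x, p x = ∑ x with P x, p x := by
  classical
  rw [← Finset.filter_filter, Finset.sum_filter]
  refine Finset.sum_congr rfl fun x _ => ?_
  split_ifs with h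
  · rfl
  · exact le_antisymm (zero_le p x) (not_lt.1 h)

theorem sum_le_one (p : stdSimplex ℝ ι) (s : Finset ι) : ∑ x ∈ s, p x ≤ 1 := by
  rw [← sum_eq_one p]
  exact Finset.sum_le_sum_of_subset_of_nonneg (subset_univ s) fun x _ _ => zero_le p x

/-- Source coding: almost all the weight of `n` samples is carried by about `exp (n S)`
sequences. -/
theorem eventually_exists_card_le (p : stdSimplex ℝ ι) {δ ε : ℝ} (hδ : 0 < δ) (hε : 0 < ε) :
    ∀ᶠ n : ℕ in Filter.atTop, ∃ A : Finset (Fin n → ι),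
      (#A : ℝ) ≤ Real.exp (n * (shannon p + δ)) ∧ 1 - ε < ∑ x ∈ A, iid p n x := by
  classical
  have hg : ∀ _k : Unit, ∑ i, p i * (-Real.log (p i) - shannon p - δ) < 0 := fun _ => by
    have h := sum_mul_log p
    simp only [mul_sub, Finset.sum_sub_distrib, mul_neg, Finset.sum_neg_distrib, h,
      ← Finset.sum_mul, sum_eq_one]
    linarith
  filter_upwards [eventually_prob_lt p (fun _ : Unit => fun i => -Real.log (p i) - shannon p - δ)
    hg hε] with n hn
  rw [← sum_filter_and_pos] at hn
  refine ⟨univ.filter fun x : Fin n → ι => (∀ _k : Unit,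
    ∑ j, (-Real.log (p (x j)) - shannon p - δ) < 0) ∧ 0 < iid p n x, ?_, hn⟩
  have hle := sum_le_one (iid p n) (univ.filter fun x : Fin n → ι =>
    (∀ _k : Unit, ∑ j, (-Real.log (p (x j)) - shannon p - δ) < 0) ∧ 0 < iid p n x)
  -- Each sequence in the set has probability at least `exp (-n (S + δ))`.
  rw [← mul_le_mul_iff_left₀ (Real.exp_pos (-(n * (shannon p + δ)))), ← Real.exp_add, add_neg_cancel,
    Real.exp_zero, ← nsmul_eq_mul]
  refine le_trans (Finset.card_nsmul_le_sum _ _ _ fun x hx => ?_) hle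
  obtain ⟨h1, h2⟩ := (mem_filter.1 hx).2
  have h1 := h1 ()
  rw [iid_eq_exp p h2, Real.exp_le_exp]
  simp only [Finset.sum_sub_distrib, Finset.sum_neg_distrib, Finset.sum_const, card_univ,
    Fintype.card_fin, nsmul_eq_mul] at h1
  linarith

/-- Typical sequences: for large `n` there is a permutation-invariant set of at least about
`exp (n S)` sequences whose empirical distributions are all close to `p`. -/
theorem eventually_exists_le_card [DecidableEq ι] (p : stdSimplex ℝ ι) {δ ε : ℝ} (hδ : 0 < δ)
    (hε : 0 < ε) :
    ∀ᶠ n : ℕ in Filter.atTop, ∃ T : Finset (Fin n → ι), T.Nonempty ∧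
      Real.exp (n * (shannon p - δ)) ≤ 2 * #T ∧
      (∀ x, ∀ σ : Equiv.Perm (Fin n), x ∘ σ ∈ T ↔ x ∈ T) ∧
      ∀ x ∈ T, ∀ i, (∑ j, ((if x j = i then 1 else 0) - p i - ε) ≤ 0) ∧
        ∑ j, (p i - (if x j = i then 1 else 0) - ε) ≤ 0 := by
  classical
  -- The events: every empirical frequency is at most `p i + ε`, respectively at least `p i - ε`, and
  -- the sequence has probability at most `exp (-n (S - δ))`.
  let g : ι ⊕ ι ⊕ Unit → ι → ℝ := Sum.elim (fun i y => (if y = i then 1 else 0) - p i - ε)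
    (Sum.elim (fun i y => p i - (if y = i then 1 else 0) - ε)
      fun _ y => Real.log (p y) + shannon p - δ)
  have hg : ∀ k, ∑ i, p i * g k i < 0 := by
    rintro (i | i | _)
    · simp [g, mul_sub, Finset.sum_sub_distrib, ← Finset.sum_mul, hε]
    · simp [g, mul_sub, Finset.sum_sub_distrib, ← Finset.sum_mul, hε]
    · have h := sum_mul_log p
      simp [g, mul_sub, mul_add, Finset.sum_sub_distrib, Finset.sum_add_distrib, ← Finset.sum_mul,
        hδ, h]
  filter_upwards [eventually_prob_lt p g hg (ε := 1 / 2) (by norm_num)] with n hn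
  rw [← sum_filter_and_pos] at hn
  refine ⟨univ.filter fun x : Fin n → ι => (∀ k, ∑ j, g k (x j) < 0) ∧ 0 < iid p n x,
    ?_, ?_, ?_, ?_⟩
  · by_contra h
    rw [Finset.not_nonempty_iff_eq_empty] at h
    rw [h] at hn
    norm_num at hn
  · have h1 : ∑ x : Fin n → ι with (∀ k, ∑ j, g k (x j) < 0) ∧ 0 < iid p n x, iid p n x
        ≤ #{x : Fin n → ι | (∀ k, ∑ j, g k (x j) < 0) ∧ 0 < iid p n x}
          • Real.exp (-(n * (shannon p - δ))) := by
      refine Finset.sum_le_card_nsmul _ _ _ fun x hx => ?_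
      obtain ⟨h1, h2⟩ := (mem_filter.1 hx).2
      have h1 := h1 (Sum.inr (Sum.inr ()))
      rw [iid_eq_exp p h2, Real.exp_le_exp]
      simp only [g, Sum.elim_inr, Finset.sum_sub_distrib, Finset.sum_add_distrib, Finset.sum_const,
        card_univ, Fintype.card_fin, nsmul_eq_mul] at h1
      linarith
    rw [nsmul_eq_mul, Real.exp_neg, ← div_eq_mul_inv] at h1
    have h2 := lt_of_lt_of_le hn h1
    rw [lt_div_iff₀ (Real.exp_pos _)] at h2
    linarith
  · intro x σ
    have h : ∀ k, ∑ j, g k ((x ∘ σ) j) = ∑ j, g k (x j) := fun k =>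
      Equiv.sum_comp σ fun j => g k (x j)
    have h' : iid p n (x ∘ σ) = iid p n x := Equiv.prod_comp σ fun j => p (x j)
    simp only [mem_filter, mem_univ, true_and, h, h']
  · intro x hx i
    obtain ⟨h1, -⟩ := (mem_filter.1 hx).2
    exact ⟨(h1 (Sum.inl i)).le, (h1 (Sum.inr (Sum.inl i))).le⟩

/-- All marginals of the uniform distribution on a permutation-invariant set agree. -/
theorem map_eval_uniformOn [DecidableEq ι] {n : ℕ} (T : Finset (Fin n → ι)) (hT : T.Nonempty)
    (hsymm : ∀ x, ∀ σ : Equiv.Perm (Fin n), x ∘ σ ∈ T ↔ x ∈ T) (j k : Fin n) :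
    map (fun x => x j) (uniformOn T hT) = map (fun x => x k) (uniformOn T hT) := by
  have h : map (Equiv.arrowCongr (Equiv.swap j k) (Equiv.refl ι)) (uniformOn T hT)
      = uniformOn T hT := by
    apply stdSimplex.ext
    funext x
    rw [map_equiv_apply, uniformOn_apply, uniformOn_apply]
    have : (Equiv.arrowCongr (Equiv.swap j k) (Equiv.refl ι)).symm x = x ∘ Equiv.swap j k := by
      funext i
      simp
    rw [this]
    simp only [hsymm]
  conv_lhs => rw [← h, map_comp_apply]
  congr 1
  funext x
  simp

/-- The common marginal of a permutation-invariant uniform distribution inherits every bound on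
empirical means. -/
theorem sum_map_eval_uniformOn_le [DecidableEq ι] {n : ℕ} (T : Finset (Fin n → ι))
    (hT : T.Nonempty) (hsymm : ∀ x, ∀ σ : Equiv.Perm (Fin n), x ∘ σ ∈ T ↔ x ∈ T) (k : Fin n)
    (g : ι → ℝ) (hg : ∀ x ∈ T, ∑ j, g (x j) ≤ 0) :
    ∑ i, map (fun x => x k) (uniformOn T hT) i * g i ≤ 0 := by
  have hn : (0 : ℝ) < n := by exact_mod_cast k.pos
  refine nonpos_of_mul_nonpos_right (a := (n : ℝ)) ?_ hn
  calc n * ∑ i, map (fun x => x k) (uniformOn T hT) i * g i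
      = ∑ j, ∑ i, map (fun x => x j) (uniformOn T hT) i * g i := by
        simp only [map_eval_uniformOn T hT hsymm _ k, Finset.sum_const, card_univ,
          Fintype.card_fin, nsmul_eq_mul]
    _ = ∑ x, uniformOn T hT x * ∑ j, g (x j) := by
        simp only [sum_map_mul, Finset.mul_sum]
        rw [Finset.sum_comm]
    _ ≤ 0 := by
        refine Finset.sum_nonpos fun x _ => ?_
        rw [uniformOn_apply]
        split_ifs with hx
        · exact mul_nonpos_of_nonneg_of_nonpos (by positivity) (hg x hx)
        · simp

end stdSimplex

/-! ### Uniqueness of the entropy deficit -/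

namespace IsNonuniformity

open Finset stdSimplex

variable {m : (ι : Type) → [Fintype ι] → stdSimplex ℝ ι → ℝ} {ι : Type} [Fintype ι]

/-- By continuity, a nearly pure bit is nearly as valuable as a pure one. -/
theorem exists_le_of_near_pure (hm : IsNonuniformity m) {η : ℝ} (hη : 0 < η) :
    ∃ ε > 0, ∀ q : stdSimplex ℝ (Fin 2), 1 - ε < q 0 →
      m (Fin 2) (vertex 0) - η ≤ m (Fin 2) q := by
  obtain ⟨ε, hε, h⟩ := Metric.continuous_iff.1 (hm.continuous (Fin 2)) (vertex 0) η hη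
  refine ⟨ε, hε, fun q hq => ?_⟩
  have hd : dist q (vertex 0) < ε := by
    rw [Subtype.dist_eq, dist_pi_lt_iff hε]
    have h1 := add_eq_one q
    have h2 := le_one q 0
    intro i
    fin_cases i
    · change |q 0 - (Pi.single 0 1 : Fin 2 → ℝ) 0| < ε
      rw [Pi.single_eq_same, abs_lt]
      constructor <;> linarith
    · change |q 1 - (Pi.single 0 1 : Fin 2 → ℝ) 1| < ε
      rw [Pi.single_eq_of_ne (by decide), abs_lt]
      constructor <;> linarith
  have := h q hd
  rw [Real.dist_eq, abs_lt] at this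
  linarith

/-- Distillation: about `n (log d - S) / log 2` nearly pure bits can be extracted from `n`
copies. -/
theorem mul_le (hm : IsNonuniformity m) (p : stdSimplex ℝ ι) :
    m (Fin 2) (vertex 0) / Real.log 2 * (Real.log (Fintype.card ι) - shannon p) ≤ m ι p := by
  set b := m (Fin 2) (vertex 0) with hb
  set L := Real.log (Fintype.card ι) - shannon p with hL
  have hb0 : 0 ≤ b := hm.nonneg _
  have hlog : 0 < Real.log 2 := Real.log_pos one_lt_two
  rcases le_or_gt L 0 with hL0 | hL0
  · exact (mul_nonpos_of_nonneg_of_nonpos (by positivity) hL0).trans (hm.nonneg p)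
  have hι : Nonempty ι := by
    by_contra h
    rw [not_nonempty_iff] at h
    simpa using sum_eq_one p
  have hcard : (0 : ℝ) < Fintype.card ι := by exact_mod_cast Fintype.card_pos
  refine le_of_forall_small (K := b / Real.log 2 + L / Real.log 2) hL0 fun δ hδ hδL => ?_
  obtain ⟨ε, hε, hnear⟩ := hm.exists_le_of_near_pure hδ
  refine le_of_eventually_mul_sub_le (C := b) ?_
  filter_upwards [eventually_exists_card_le p hδ hε] with n ⟨A, hA, hAp⟩
  set l := ⌊n * (L - δ) / Real.log 2⌋₊ with hl
  have hpos : 0 ≤ n * (L - δ) / Real.log 2 :=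
    div_nonneg (mul_nonneg n.cast_nonneg (by linarith)) hlog.le
  have hl1 : l ≤ n * (L - δ) / Real.log 2 := Nat.floor_le hpos
  have hl2 : n * (L - δ) / Real.log 2 < l + 1 := Nat.lt_floor_add_one _
  have hcount : #A * 2 ^ l ≤ Fintype.card (Fin n → ι) := by
    have h2 : (2 : ℝ) ^ l ≤ Real.exp (n * (L - δ)) := by
      rw [← Real.exp_log (show (0 : ℝ) < 2 ^ l by positivity), Real.exp_le_exp, Real.log_pow]
      rwa [← le_div_iff₀ hlog]
    have h3 : Real.exp (n * (shannon p + δ)) * Real.exp (n * (L - δ))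
        = (Fintype.card ι : ℝ) ^ n := by
      rw [← Real.exp_add, ← Real.exp_log (pow_pos hcard n), Real.log_pow]
      congr 1
      rw [hL]
      ring
    have : (#A : ℝ) * 2 ^ l ≤ (Fintype.card ι : ℝ) ^ n :=
      h3 ▸ mul_le_mul hA h2 (by positivity) (Real.exp_pos _).le
    rw [Fintype.card_fun, Fintype.card_fin]
    exact_mod_cast this
  obtain ⟨q, hq, hq0⟩ := hm.exists_bits_of_card_le (stdSimplex.iid p n) A hcount
  have hbits : l * (b - δ) ≤ n * m ι p := by
    calc l * (b - δ) = ∑ _j : Fin l, (b - δ) := by simp [mul_sub]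
      _ ≤ ∑ j, m (Fin 2) (map (fun x => x j) q) := by
          refine Finset.sum_le_sum fun j _ => hnear _ (hAp.trans_le (hq0.trans ?_))
          rw [map_apply]
          exact Finset.single_le_sum (f := fun x => q x) (fun x _ => zero_le q x) (by simp)
      _ ≤ n * m ι p := (hm.sum_marginals_le q).trans (hq.trans_eq (hm.iid p n))
  have h1 : b * (n * (L - δ) / Real.log 2 - 1) ≤ b * l :=
    mul_le_mul_of_nonneg_left (by linarith) hb0
  have h2 : δ * l ≤ δ * (n * L / Real.log 2) := by
    refine mul_le_mul_of_nonneg_left (hl1.trans ?_) hδ.le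
    gcongr
    linarith
  calc n * (b / Real.log 2 * L - δ * (b / Real.log 2 + L / Real.log 2)) - b
      = b * (n * (L - δ) / Real.log 2 - 1) - δ * (n * L / Real.log 2) := by ring
    _ ≤ n * m ι p := by linarith

/-- Formation: about `n (log d - S) / log 2` pure bits suffice to create correlated systems
whose marginals are all close to the given distribution. -/
theorem le_mul (hm : IsNonuniformity m) (p : stdSimplex ℝ ι) :
    m ι p ≤ m (Fin 2) (vertex 0) / Real.log 2 * (Real.log (Fintype.card ι) - shannon p) := by
  classical
  set b := m (Fin 2) (vertex 0) with hb
  set L := Real.log (Fintype.card ι) - shannon p with hL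
  have hb0 : 0 ≤ b := hm.nonneg _
  have hlog : 0 < Real.log 2 := Real.log_pos one_lt_two
  have hι : Nonempty ι := by
    by_contra h
    rw [not_nonempty_iff] at h
    simpa using sum_eq_one p
  have hcard : (0 : ℝ) < Fintype.card ι := by exact_mod_cast Fintype.card_pos
  refine le_of_forall_small (δ₀ := 1) (K := 1 + b / Real.log 2) one_pos fun δ hδ _ => ?_
  obtain ⟨ε, hε, hcont⟩ := Metric.continuous_iff.1 (hm.continuous ι) p δ hδ
  refine le_of_eventually_mul_sub_le (C := 2 * b) ?_
  filter_upwards [eventually_exists_le_card p hδ (half_pos hε), Filter.eventually_gt_atTop 0]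
    with n ⟨T, hT, hTcard, hsymm, hTyp⟩ hn
  have hTpos : (0 : ℝ) < #T := by exact_mod_cast hT.card_pos
  set l := ⌈Real.log ((Fintype.card ι : ℝ) ^ n / #T) / Real.log 2⌉₊ with hl
  have hle : (#T : ℝ) ≤ (Fintype.card ι : ℝ) ^ n := by
    have := Finset.card_le_univ T
    rw [Fintype.card_fun, Fintype.card_fin] at this
    exact_mod_cast this
  have hratio : 0 < (Fintype.card ι : ℝ) ^ n / #T := by positivity
  have hl1 : Real.log ((Fintype.card ι : ℝ) ^ n / #T) / Real.log 2 ≤ l := Nat.le_ceil _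
  have hl2 : l < Real.log ((Fintype.card ι : ℝ) ^ n / #T) / Real.log 2 + 1 :=
    Nat.ceil_lt_add_one (div_nonneg (Real.log_nonneg ((one_le_div hTpos).2 hle)) hlog.le)
  have hcount : Fintype.card (Fin n → ι) ≤ 2 ^ l * #T := by
    have h1 : (Fintype.card ι : ℝ) ^ n / #T ≤ 2 ^ l := by
      rw [← Real.log_le_log_iff hratio (by positivity), Real.log_pow]
      rwa [div_le_iff₀ hlog] at hl1
    rw [div_le_iff₀ hTpos] at h1
    rw [Fintype.card_fun, Fintype.card_fin]
    exact_mod_cast h1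
  have hbits : (l : ℝ) * Real.log 2 ≤ n * (L + δ) + 2 * Real.log 2 := by
    have h1 : n * (shannon p - δ) ≤ Real.log 2 + Real.log #T := by
      rw [← Real.log_mul two_ne_zero hTpos.ne']
      exact (Real.le_log_iff_exp_le (by positivity)).2 hTcard
    have h2 : Real.log ((Fintype.card ι : ℝ) ^ n / #T)
        = n * Real.log (Fintype.card ι) - Real.log #T := by
      rw [Real.log_div (by positivity) hTpos.ne', Real.log_pow]
    have h3 := mul_le_mul_of_nonneg_right hl2.le hlog.le
    rw [add_mul, div_mul_cancel₀ _ hlog.ne', h2] at h3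
    rw [hL]
    linarith
  -- By symmetry all marginals equal this one.
  set k : Fin n := ⟨0, hn⟩
  set q := map (fun x => x k) (uniformOn T hT) with hq
  have hqp : dist q p < ε := by
    rw [Subtype.dist_eq, dist_pi_lt_iff hε]
    intro i
    have h1 := sum_map_eval_uniformOn_le T hT hsymm k
      (fun y => (if y = i then 1 else 0) - p i - ε / 2) fun x hx => (hTyp x hx i).1
    have h2 := sum_map_eval_uniformOn_le T hT hsymm k
      (fun y => p i - (if y = i then 1 else 0) - ε / 2) fun x hx => (hTyp x hx i).2
    rw [← hq] at h1 h2
    simp only [mul_sub, Finset.sum_sub_distrib, ← Finset.sum_mul, sum_eq_one, one_mul, mul_ite,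
      mul_one, mul_zero, Finset.sum_ite_eq', mem_univ, if_true] at h1 h2
    change |q i - p i| < ε
    rw [abs_lt]
    constructor <;> linarith
  have hpq : m ι p - δ ≤ m ι q := by
    have := hcont q hqp
    rw [Real.dist_eq, abs_lt] at this
    linarith
  have hmarg : n * m ι q ≤ l * b := by
    refine le_trans ?_ ((hm.sum_marginals_le (uniformOn T hT)).trans (hm.uniformOn_le T hT hcount))
    simp only [map_eval_uniformOn T hT hsymm _ k, Finset.sum_const, card_univ, Fintype.card_fin,
      nsmul_eq_mul]
    exact le_rfl
  have h1 := mul_le_mul_of_nonneg_left hpq (Nat.cast_nonneg (α := ℝ) n)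
  have h2 : (l : ℝ) * b ≤ (n * (L + δ) + 2 * Real.log 2) * (b / Real.log 2) := by
    have := mul_le_mul_of_nonneg_right hbits (div_nonneg hb0 hlog.le)
    rwa [mul_assoc, mul_div_cancel₀ _ hlog.ne'] at this
  have h3 : (n * (L + δ) + 2 * Real.log 2) * (b / Real.log 2)
      = n * (b / Real.log 2 * L) + n * δ * (b / Real.log 2) + 2 * b := by
    field_simp
  linarith

/-- Up to a factor, the only measure of nonuniformity is the entropy deficit. -/
theorem eq_mul (hm : IsNonuniformity m) (p : stdSimplex ℝ ι) :
    m ι p = m (Fin 2) (vertex 0) / Real.log 2 * (Real.log (Fintype.card ι) - shannon p) :=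
  le_antisymm (hm.le_mul p) (hm.mul_le p)

end IsNonuniformity

/-! ### Unitary diagonalization -/

/-- `A = U d U†`, where `U` is a unitary from `ℂ^κ` onto `ℂ^ι` and `d` is a real diagonal
matrix. -/
structure Diagonalizes {ι κ : Type} [Fintype ι] [DecidableEq ι] [Fintype κ] [DecidableEq κ]
    (A : Matrix ι ι ℂ) (U : Matrix ι κ ℂ) (d : κ → ℝ) : Prop where
  conjTranspose_mul : Uᴴ * U = 1
  mul_conjTranspose : U * Uᴴ = 1
  eq : A = U * Matrix.diagonal (fun k => (d k : ℂ)) * Uᴴ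

namespace Matrix

theorem IsHermitian.diagonalizes {ι : Type} [Fintype ι] [DecidableEq ι] {A : Matrix ι ι ℂ}
    (hA : A.IsHermitian) : Diagonalizes A (hA.eigenvectorUnitary : Matrix ι ι ℂ) hA.eigenvalues where
  conjTranspose_mul := Unitary.coe_star_mul_self _
  mul_conjTranspose := Unitary.coe_mul_star_self _
  eq := by
    conv_lhs => rw [hA.spectral_theorem, Unitary.conjStarAlgAut_apply]
    rfl

end Matrix

namespace Diagonalizes

open Matrix

variable {ι κ ι' κ' : Type} [Fintype ι] [DecidableEq ι] [Fintype κ] [DecidableEq κ]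
  [Fintype ι'] [DecidableEq ι'] [Fintype κ'] [DecidableEq κ'] {A : Matrix ι ι ℂ}
  {B : Matrix ι' ι' ℂ} {U : Matrix ι κ ℂ} {V : Matrix ι' κ' ℂ} {d : κ → ℝ} {e : κ' → ℝ}

theorem card_eq (h : Diagonalizes A U d) : Fintype.card ι = Fintype.card κ :=
  Matrix.square_of_invertible U Uᴴ h.mul_conjTranspose h.conjTranspose_mul

/-- Functions of the eigenvalues can be summed along any diagonalization. -/
theorem sum_eigenvalues (h : Diagonalizes A U d) (hA : A.IsHermitian) (f : ℝ → ℝ) :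
    ∑ i, f (hA.eigenvalues i) = ∑ k, f (d k) := by
  have hchar : A.charpoly = (diagonal fun k => (d k : ℂ)).charpoly := by
    have h1 := charpoly_mul_comm' (U * diagonal fun k => (d k : ℂ)) Uᴴ
    rw [← h.eq, ← Matrix.mul_assoc, h.conjTranspose_mul, Matrix.one_mul, h.card_eq] at h1
    exact mul_left_cancel₀ (pow_ne_zero _ Polynomial.X_ne_zero) h1
  have hroots := hA.roots_charpoly_eq_eigenvalues
  rw [hchar, charpoly_diagonal, Polynomial.roots_prod _ _
    (Finset.prod_ne_zero_iff.2 fun k _ => Polynomial.X_sub_C_ne_zero _)] at hroots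
  have h2 := congrArg (fun s => (s.map fun z : ℂ => f z.re).sum) hroots
  simpa [Function.comp_def] using h2.symm

theorem trace_eq (h : Diagonalizes A U d) : A.trace = ((∑ k, d k : ℝ) : ℂ) := by
  rw [h.eq, Matrix.mul_assoc, Matrix.trace_mul_comm, Matrix.mul_assoc, h.conjTranspose_mul,
    Matrix.mul_one, trace_diagonal]
  push_cast
  rfl

theorem mul {A' : Matrix ι ι ℂ} {d' : κ → ℝ} (h : Diagonalizes A U d) (h' : Diagonalizes A' U d') :
    Diagonalizes (A * A') U fun k => d k * d' k where
  conjTranspose_mul := h.conjTranspose_mul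
  mul_conjTranspose := h.mul_conjTranspose
  eq := by
    have : (diagonal fun k => ((d k * d' k : ℝ) : ℂ))
        = diagonal (fun k => (d k : ℂ)) * (Uᴴ * U) * diagonal (fun k => (d' k : ℂ)) := by
      rw [h.conjTranspose_mul, Matrix.mul_one, diagonal_mul_diagonal]
      push_cast
      rfl
    rw [this, h.eq, h'.eq]
    simp only [Matrix.mul_assoc]

theorem add {A' : Matrix ι ι ℂ} {d' : κ → ℝ} (h : Diagonalizes A U d) (h' : Diagonalizes A' U d') :
    Diagonalizes (A + A') U fun k => d k + d' k where
  conjTranspose_mul := h.conjTranspose_mul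
  mul_conjTranspose := h.mul_conjTranspose
  eq := by
    have : (diagonal fun k => ((d k + d' k : ℝ) : ℂ))
        = diagonal (fun k => (d k : ℂ)) + diagonal (fun k => (d' k : ℂ)) := by
      rw [diagonal_add]
      push_cast
      rfl
    rw [this, h.eq, h'.eq, Matrix.mul_add, Matrix.add_mul]

theorem smul (h : Diagonalizes A U d) (c : ℝ) :
    Diagonalizes ((c : ℂ) • A) U fun k => c * d k where
  conjTranspose_mul := h.conjTranspose_mul
  mul_conjTranspose := h.mul_conjTranspose
  eq := by
    have : (diagonal fun k => ((c * d k : ℝ) : ℂ)) = (c : ℂ) • diagonal (fun k => (d k : ℂ)) := by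
      rw [← diagonal_smul]
      congr 1
      funext k
      simp
    rw [this, h.eq, Matrix.mul_smul, Matrix.smul_mul]

/-- Every unitary diagonalizes the identity. -/
theorem one (h : Diagonalizes A U d) : Diagonalizes (1 : Matrix ι ι ℂ) U fun _ => 1 where
  conjTranspose_mul := h.conjTranspose_mul
  mul_conjTranspose := h.mul_conjTranspose
  eq := by simp [h.mul_conjTranspose]

/-- Functional calculus in a fixed eigenbasis. -/
theorem ofDiagonal (h : Diagonalizes A U d) (x : κ → ℝ) :
    Diagonalizes (U * diagonal (fun k => (x k : ℂ)) * Uᴴ) U x where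
  conjTranspose_mul := h.conjTranspose_mul
  mul_conjTranspose := h.mul_conjTranspose
  eq := rfl

theorem conj (h : Diagonalizes A U d) {W : Matrix ι' ι ℂ} (hW : Wᴴ * W = 1) (hW' : W * Wᴴ = 1) :
    Diagonalizes (W * A * Wᴴ) (W * U) d where
  conjTranspose_mul := by
    rw [Matrix.conjTranspose_mul, Matrix.mul_assoc, ← Matrix.mul_assoc Wᴴ, hW, Matrix.one_mul,
      h.conjTranspose_mul]
  mul_conjTranspose := by
    rw [Matrix.conjTranspose_mul, Matrix.mul_assoc, ← Matrix.mul_assoc U, h.mul_conjTranspose,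
      Matrix.one_mul, hW']
  eq := by
    rw [h.eq, Matrix.conjTranspose_mul]
    simp only [Matrix.mul_assoc]

theorem kronecker (h : Diagonalizes A U d) (h' : Diagonalizes B V e) :
    Diagonalizes (A ⊗ₖ B) (U ⊗ₖ V) fun k => d k.1 * e k.2 where
  conjTranspose_mul := by
    rw [conjTranspose_kronecker, ← mul_kronecker_mul, h.conjTranspose_mul, h'.conjTranspose_mul,
      one_kronecker_one]
  mul_conjTranspose := by
    rw [conjTranspose_kronecker, ← mul_kronecker_mul, h.mul_conjTranspose, h'.mul_conjTranspose,
      one_kronecker_one]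
  eq := by
    have : (diagonal fun k : κ × κ' => ((d k.1 * e k.2 : ℝ) : ℂ))
        = diagonal (fun k => (d k : ℂ)) ⊗ₖ diagonal (fun k => (e k : ℂ)) := by
      rw [diagonal_kronecker_diagonal]
      push_cast
      rfl
    rw [this, conjTranspose_kronecker, ← mul_kronecker_mul, ← mul_kronecker_mul, ← h.eq, ← h'.eq]

theorem nonInteracting (h : Diagonalizes A U d) (h' : Diagonalizes B V e) :
    Diagonalizes (A ⊗ₖ (1 : Matrix ι' ι' ℂ) + (1 : Matrix ι ι ℂ) ⊗ₖ B) (U ⊗ₖ V)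
      fun k => d k.1 + e k.2 := by
  simpa using (h.kronecker h'.one).add (h.one.kronecker h')

theorem exp {U : Matrix ι ι ℂ} {d : ι → ℝ} (h : Diagonalizes A U d) :
    Diagonalizes (NormedSpace.exp A) U fun k => Real.exp (d k) where
  conjTranspose_mul := h.conjTranspose_mul
  mul_conjTranspose := h.mul_conjTranspose
  eq := by
    have hinv : U⁻¹ = Uᴴ := Matrix.inv_eq_right_inv h.mul_conjTranspose
    have hU : IsUnit U := ⟨⟨U, Uᴴ, h.mul_conjTranspose, h.conjTranspose_mul⟩, rfl⟩
    conv_lhs => rw [h.eq, ← hinv, Matrix.exp_conj _ _ hU, Matrix.exp_diagonal, hinv]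
    congr 3
    funext k
    simp [Complex.exp_eq_exp_ℂ]

end Diagonalizes

/-! ### The variational principle and subadditivity of the entropy -/

namespace Diagonalizes

open Matrix

variable {ι κ κ' : Type} [Fintype ι] [DecidableEq ι] [Fintype κ] [DecidableEq κ]
  [Fintype κ'] [DecidableEq κ'] {A B : Matrix ι ι ℂ}
  {U : Matrix ι κ ℂ} {V : Matrix ι κ' ℂ} {d : κ → ℝ} {e : κ' → ℝ}

/-- The transition probabilities between two orthonormal bases are doubly stochastic. -/
theorem sum_normSq_right (h : Diagonalizes A U d) (h' : Diagonalizes B V e) (j : κ) :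
    ∑ k, Complex.normSq ((Uᴴ * V) j k) = 1 := by
  have h1 : (Uᴴ * V) * (Uᴴ * V)ᴴ = 1 := by
    rw [Matrix.conjTranspose_mul, conjTranspose_conjTranspose, Matrix.mul_assoc,
      ← Matrix.mul_assoc V, h'.mul_conjTranspose, Matrix.one_mul, h.conjTranspose_mul]
  have h2 := congrFun (congrFun h1 j) j
  simp only [Matrix.mul_apply (M := Uᴴ * V), conjTranspose_apply, one_apply_eq,
    Complex.star_def, Complex.mul_conj] at h2
  exact_mod_cast h2

theorem sum_normSq_left (h : Diagonalizes A U d) (h' : Diagonalizes B V e) (k : κ') :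
    ∑ j, Complex.normSq ((Uᴴ * V) j k) = 1 := by
  rw [← h'.sum_normSq_right h k]
  refine Finset.sum_congr rfl fun j _ => ?_
  have : (Vᴴ * U) = (Uᴴ * V)ᴴ := by simp
  rw [this, conjTranspose_apply, Complex.star_def, Complex.normSq_conj]

/-- The trace of a product, as a sum over pairs of eigenvalues weighted with the transition
probabilities between the two eigenbases. -/
theorem trace_mul (h : Diagonalizes A U d) (h' : Diagonalizes B V e) :
    (A * B).trace.re = ∑ j, ∑ k, Complex.normSq ((Uᴴ * V) j k) * (d j * e k) := by
  have h1 : (A * B).trace = (diagonal (fun k => (d k : ℂ)) * (Uᴴ * V)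
      * (diagonal (fun k => (e k : ℂ)) * (Uᴴ * V)ᴴ)).trace := by
    conv_lhs => rw [h.eq, h'.eq]
    rw [Matrix.mul_assoc U, Matrix.mul_assoc U, Matrix.trace_mul_comm U, Matrix.conjTranspose_mul,
      conjTranspose_conjTranspose]
    simp only [Matrix.mul_assoc]
  rw [h1, Matrix.trace, Complex.re_sum]
  refine Finset.sum_congr rfl fun j _ => ?_
  rw [diag_apply, Matrix.mul_apply, Complex.re_sum]
  refine Finset.sum_congr rfl fun k _ => ?_
  rw [diagonal_mul, diagonal_mul, conjTranspose_apply, Complex.star_def]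
  have : (d j : ℂ) * (Uᴴ * V) j k * ((e k : ℂ) * (starRingEnd ℂ) ((Uᴴ * V) j k))
      = ((Complex.normSq ((Uᴴ * V) j k) * (d j * e k) : ℝ) : ℂ) := by
    push_cast
    rw [← Complex.mul_conj]
    ring
  rw [this, Complex.ofReal_re]

end Diagonalizes

theorem Real.negMulLog_add_mul_log_le {x s : ℝ} (hx : 0 ≤ x) (hs : 0 < s) :
    negMulLog x + x * log s ≤ s - x := by
  rcases hx.eq_or_lt with rfl | hx
  · simpa using hs.le
  · have h := Real.log_le_sub_one_of_pos (div_pos hs hx)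
    rw [Real.log_div hs.ne' hx.ne'] at h
    have := mul_le_mul_of_nonneg_left h hx.le
    rw [mul_sub, mul_sub, mul_div_cancel₀ _ hx.ne'] at this
    rw [Real.negMulLog]
    linarith

namespace DensityMatrix

open Matrix

variable {ι κ : Type} [Fintype ι] [DecidableEq ι] [Fintype κ] [DecidableEq κ]

theorem entropy_eq (ρ : DensityMatrix ι) {U : Matrix ι κ ℂ} {d : κ → ℝ}
    (h : Diagonalizes ρ.mat U d) : ρ.entropy = ∑ k, Real.negMulLog (d k) :=
  h.sum_eigenvalues ρ.posSemidef.isHermitian Real.negMulLog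

theorem sum_eigenvalues (ρ : DensityMatrix ι) :
    ∑ i, ρ.posSemidef.isHermitian.eigenvalues i = 1 := by
  have h := ρ.posSemidef.isHermitian.diagonalizes.trace_eq
  rw [ρ.trace_eq_one] at h
  exact_mod_cast h.symm

/-- Gibbs variational principle (Klein's inequality for `ρ` and the Gibbs state of `X`). -/
theorem entropy_le_trace_add_log (ρ : DensityMatrix ι) {X : Matrix ι ι ℂ} {V : Matrix ι κ ℂ}
    {x : κ → ℝ} (h : Diagonalizes X V x) :
    ρ.entropy ≤ (ρ.mat * X).trace.re + Real.log (∑ k, Real.exp (-x k)) := by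
  have hρ := ρ.posSemidef.isHermitian.diagonalizes
  set U := (ρ.posSemidef.isHermitian.eigenvectorUnitary : Matrix ι ι ℂ)
  set r := ρ.posSemidef.isHermitian.eigenvalues
  have hr : ∀ j, 0 ≤ r j := ρ.posSemidef.eigenvalues_nonneg
  have hsum : ∑ j, r j = 1 := ρ.sum_eigenvalues
  have hκ : Nonempty κ := by
    have := ρ.nonempty_index
    rw [← Fintype.card_pos_iff, ← h.card_eq]
    exact Fintype.card_pos
  set Z := ∑ k, Real.exp (-x k) with hZ
  have hZpos : 0 < Z := Finset.sum_pos (fun k _ => Real.exp_pos _) Finset.univ_nonempty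
  have key : ∑ j, ∑ k, Complex.normSq ((Uᴴ * V) j k) *
        (Real.negMulLog (r j) + r j * Real.log (Real.exp (-x k) / Z))
      ≤ ∑ j, ∑ k, Complex.normSq ((Uᴴ * V) j k) * (Real.exp (-x k) / Z - r j) :=
    Finset.sum_le_sum fun j _ => Finset.sum_le_sum fun k _ =>
      mul_le_mul_of_nonneg_left (Real.negMulLog_add_mul_log_le (hr j) (by positivity))
        (Complex.normSq_nonneg _)
  have hcol : ∀ f : κ → ℝ, ∑ j, ∑ k, Complex.normSq ((Uᴴ * V) j k) * f k = ∑ k, f k := fun f => by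
    rw [Finset.sum_comm]
    refine Finset.sum_congr rfl fun k _ => ?_
    rw [← Finset.sum_mul, hρ.sum_normSq_left h, one_mul]
  have hrow : ∀ f : ι → ℝ, ∑ j, ∑ k, Complex.normSq ((Uᴴ * V) j k) * f j = ∑ j, f j := fun f => by
    refine Finset.sum_congr rfl fun j _ => ?_
    rw [← Finset.sum_mul, hρ.sum_normSq_right h, one_mul]
  have hlog : ∀ k, Real.log (Real.exp (-x k) / Z) = -x k - Real.log Z := fun k => by
    rw [Real.log_div (Real.exp_pos _).ne' hZpos.ne', Real.log_exp]
  have hR : ∑ k, Real.exp (-x k) / Z = 1 := by rw [← Finset.sum_div, ← hZ, div_self hZpos.ne']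
  have hsplit : ∑ j, ∑ k, Complex.normSq ((Uᴴ * V) j k) *
        (Real.negMulLog (r j) + r j * Real.log (Real.exp (-x k) / Z))
      = ρ.entropy - (ρ.mat * X).trace.re - Real.log Z := by
    rw [hρ.trace_mul h, ρ.entropy_eq hρ, ← hrow fun j => Real.negMulLog (r j)]
    have h1 := hrow fun j => r j * Real.log Z
    rw [← Finset.sum_mul, hsum, one_mul] at h1
    conv_rhs => rw [← h1]
    simp only [← Finset.sum_sub_distrib]
    refine Finset.sum_congr rfl fun j _ => Finset.sum_congr rfl fun k _ => ?_
    rw [hlog]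
    ring
  simp only [mul_sub, Finset.sum_sub_distrib] at key
  rw [hsplit, hcol, hrow, hR, hsum] at key
  linarith

theorem entropy_tensor (ρ : DensityMatrix ι) (σ : DensityMatrix κ) :
    (ρ.tensor σ).entropy = ρ.entropy + σ.entropy := by
  have hρ := ρ.posSemidef.isHermitian.diagonalizes
  have hσ := σ.posSemidef.isHermitian.diagonalizes
  rw [(ρ.tensor σ).entropy_eq (hρ.kronecker hσ), ρ.entropy_eq hρ, σ.entropy_eq hσ,
    Fintype.sum_prod_type]
  simp only [Real.negMulLog_mul, Finset.sum_add_distrib, ← Finset.mul_sum, ← Finset.sum_mul,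
    ρ.sum_eigenvalues, σ.sum_eigenvalues, one_mul]

theorem entropy_conj (U : Matrix κ ι ℂ) (hU : Uᴴ * U = 1) (hU' : U * Uᴴ = 1)
    (ρ : DensityMatrix ι) : (ρ.conj U hU).entropy = ρ.entropy := by
  have hρ := ρ.posSemidef.isHermitian.diagonalizes
  rw [(ρ.conj U hU).entropy_eq (hρ.conj hU hU'), ρ.entropy_eq hρ]

theorem trace_mul_kronecker_one {ι κ : Type} [Fintype ι] [Fintype κ] [DecidableEq κ]
    (ρ : DensityMatrix (ι × κ)) (X : Matrix ι ι ℂ) :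
    (ρ.mat * (X ⊗ₖ (1 : Matrix κ κ ℂ))).trace = (ρ.marginalLeft.mat * X).trace := by
  simp only [Matrix.trace, diag_apply, Matrix.mul_apply, Fintype.sum_prod_type, kroneckerMap_apply,
    marginalLeft, of_apply, Finset.sum_mul, one_apply, mul_ite, mul_one, mul_zero,
    Finset.sum_ite_eq', Finset.mem_univ, if_true]
  refine Finset.sum_congr rfl fun i _ => ?_
  rw [Finset.sum_comm]

theorem trace_mul_one_kronecker {ι κ : Type} [Fintype ι] [Fintype κ] [DecidableEq ι]
    (ρ : DensityMatrix (ι × κ)) (Y : Matrix κ κ ℂ) :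
    (ρ.mat * ((1 : Matrix ι ι ℂ) ⊗ₖ Y)).trace = (ρ.marginalRight.mat * Y).trace := by
  simp only [Matrix.trace, diag_apply, Matrix.mul_apply, Fintype.sum_prod_type, kroneckerMap_apply,
    marginalRight, of_apply, Finset.sum_mul, one_apply, ite_mul, one_mul, zero_mul, mul_ite,
    mul_zero]
  rw [Finset.sum_comm]
  refine Finset.sum_congr rfl fun k _ => ?_
  simp only [Finset.sum_comm (s := (Finset.univ : Finset ι)) (t := (Finset.univ : Finset κ))]
  refine Finset.sum_congr rfl fun l _ => ?_
  simp

/-- There is an observable `X` for which the Gibbs variational bound on the entropy is attained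
up to `ε d`: the regularised `-log ρ`. -/
theorem exists_trace_add_log_le (ρ : DensityMatrix ι) {ε : ℝ} (hε : 0 < ε) :
    ∃ (X U : Matrix ι ι ℂ) (x : ι → ℝ), Diagonalizes X U x ∧
      (ρ.mat * X).trace.re + Real.log (∑ k, Real.exp (-x k))
        ≤ ρ.entropy + ε * Fintype.card ι := by
  have hρ := ρ.posSemidef.isHermitian.diagonalizes
  set r := ρ.posSemidef.isHermitian.eigenvalues
  have hr : ∀ j, 0 ≤ r j := ρ.posSemidef.eigenvalues_nonneg
  have hsum : ∑ j, r j = 1 := ρ.sum_eigenvalues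
  refine ⟨_, _, fun k => -Real.log (r k + ε), hρ.ofDiagonal _, ?_⟩
  rw [(hρ.mul (hρ.ofDiagonal _)).trace_eq, Complex.ofReal_re, ρ.entropy_eq hρ]
  refine add_le_add (Finset.sum_le_sum fun k _ => ?_) ?_
  · rw [Real.negMulLog, mul_neg, neg_mul, neg_le_neg_iff]
    rcases (hr k).eq_or_lt with h | h
    · simp [← h]
    · exact mul_le_mul_of_nonneg_left (Real.log_le_log h (by linarith)) h.le
  · have h1 : ∑ k, Real.exp (- -Real.log (r k + ε)) = 1 + ε * Fintype.card ι := by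
      simp only [neg_neg]
      rw [Finset.sum_congr rfl fun k _ => Real.exp_log (add_pos_of_nonneg_of_pos (hr k) hε),
        Finset.sum_add_distrib, hsum]
      simp [mul_comm]
    rw [h1]
    refine (Real.log_le_sub_one_of_pos (by positivity)).trans_eq (by ring)

/-- Subadditivity of the entropy, from the variational principle for the non-interacting observable
`X ⊗ 1 + 1 ⊗ Y` with `X` and `Y` nearly optimal for the two marginals. -/
theorem entropy_le_marginals (ρ : DensityMatrix (ι × κ)) :
    ρ.entropy ≤ ρ.marginalLeft.entropy + ρ.marginalRight.entropy := by
  refine le_of_forall_small (δ₀ := 1) (K := Fintype.card ι + Fintype.card κ) one_pos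
    fun ε hε _ => ?_
  obtain ⟨X, U, x, hX, hxle⟩ := ρ.marginalLeft.exists_trace_add_log_le hε
  obtain ⟨Y, V, y, hY, hyle⟩ := ρ.marginalRight.exists_trace_add_log_le hε
  have h := ρ.entropy_le_trace_add_log (hX.nonInteracting hY)
  rw [Matrix.mul_add, Matrix.trace_add, trace_mul_kronecker_one, trace_mul_one_kronecker,
    Complex.add_re, Fintype.sum_prod_type] at h
  simp only [neg_add, Real.exp_add, ← Finset.mul_sum, ← Finset.sum_mul] at h
  have hι := ρ.marginalLeft.nonempty_index
  have hκ := ρ.marginalRight.nonempty_index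
  rw [Real.log_mul (Finset.sum_pos (fun k _ => Real.exp_pos _) Finset.univ_nonempty).ne'
    (Finset.sum_pos (fun k _ => Real.exp_pos _) Finset.univ_nonempty).ne'] at h
  linarith

end DensityMatrix

/-! ### States -/

theorem DensityMatrix.ext_mat {ι : Type} [Fintype ι] {ρ σ : DensityMatrix ι}
    (h : ρ.mat = σ.mat) : ρ = σ := by
  cases ρ
  cases σ
  cases h
  rfl

theorem Hamiltonian.ext_mat {ι : Type} {H K : Hamiltonian ι}
    (h : H.mat = K.mat) : H = K := by
  cases H
  cases K
  cases h
  rfl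

theorem DensityMatrix.marginalLeft_tensor {ι κ : Type} [Fintype ι] [Fintype κ]
    (ρ : DensityMatrix ι) (σ : DensityMatrix κ) : (ρ.tensor σ).marginalLeft = ρ := by
  apply DensityMatrix.ext_mat
  ext i j
  have h := σ.trace_eq_one
  simp only [Matrix.trace, Matrix.diag_apply] at h
  simp [DensityMatrix.marginalLeft, DensityMatrix.tensor, ← Finset.mul_sum, h]

theorem DensityMatrix.marginalRight_tensor {ι κ : Type} [Fintype ι] [Fintype κ]
    (ρ : DensityMatrix ι) (σ : DensityMatrix κ) : (ρ.tensor σ).marginalRight = σ := by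
  apply DensityMatrix.ext_mat
  ext i j
  have h := ρ.trace_eq_one
  simp only [Matrix.trace, Matrix.diag_apply] at h
  simp [DensityMatrix.marginalRight, DensityMatrix.tensor, ← Finset.sum_mul, h]

namespace DensityMatrix

variable {ι : Type} [Fintype ι]

theorem continuous_mat : Continuous (DensityMatrix.mat : DensityMatrix ι → Matrix ι ι ℂ) :=
  continuous_induced_dom

/-- By Weierstrass approximation the entropy is a uniform limit of linear combinations of the power
sums `Tr (ρ ^ n)`. -/
theorem continuous_entropy [DecidableEq ι] :
    Continuous (DensityMatrix.entropy : DensityMatrix ι → ℝ) := by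
  have hpow : ∀ (ρ : DensityMatrix ι) (n : ℕ), (ρ.mat ^ n).trace.re
      = ∑ k, ρ.posSemidef.isHermitian.eigenvalues k ^ n := by
    intro ρ n
    have hρ := ρ.posSemidef.isHermitian.diagonalizes
    have h : Diagonalizes (ρ.mat ^ n)
        (ρ.posSemidef.isHermitian.eigenvectorUnitary : Matrix ι ι ℂ)
        fun k => ρ.posSemidef.isHermitian.eigenvalues k ^ n := by
      induction n with
      | zero => simpa using hρ.one
      | succ n ih => simpa only [pow_succ] using ih.mul hρ
    rw [h.trace_eq, Complex.ofReal_re]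
  refine continuous_of_uniform_approx_of_continuous fun u hu => ?_
  obtain ⟨ε, hε, hu⟩ := Metric.mem_uniformity_dist.1 hu
  obtain ⟨q, hq⟩ := exists_polynomial_near_of_continuousOn 0 1 Real.negMulLog
    Real.continuous_negMulLog.continuousOn (ε / (Fintype.card ι + 1)) (by positivity)
  refine ⟨fun ρ => ∑ n ∈ Finset.range (q.natDegree + 1), q.coeff n * (ρ.mat ^ n).trace.re, ?_,
    fun ρ => hu ?_⟩
  · refine continuous_finsetSum _ fun n _ => continuous_const.mul ?_
    exact Complex.continuous_re.comp ((continuous_mat.pow n).matrix_trace)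
  · have h1 : ∑ n ∈ Finset.range (q.natDegree + 1), q.coeff n * (ρ.mat ^ n).trace.re
        = ∑ k, q.eval (ρ.posSemidef.isHermitian.eigenvalues k) := by
      simp only [hpow, Polynomial.eval_eq_sum_range, Finset.mul_sum]
      rw [Finset.sum_comm]
    have h0 : ∀ k, 0 ≤ ρ.posSemidef.isHermitian.eigenvalues k := ρ.posSemidef.eigenvalues_nonneg
    beta_reduce
    rw [h1, Real.dist_eq, DensityMatrix.entropy, ← Finset.sum_sub_distrib]
    calc |∑ k, (Real.negMulLog (ρ.posSemidef.isHermitian.eigenvalues k)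
            - q.eval (ρ.posSemidef.isHermitian.eigenvalues k))|
        ≤ ∑ _k : ι, ε / (Fintype.card ι + 1) := by
          refine (Finset.abs_sum_le_sum_abs _ _).trans (Finset.sum_le_sum fun k _ => ?_)
          rw [abs_sub_comm]
          refine (hq _ ⟨h0 k, ?_⟩).le
          rw [← ρ.sum_eigenvalues]
          exact Finset.single_le_sum (fun j _ => h0 j) (Finset.mem_univ k)
      _ = ε * (Fintype.card ι / (Fintype.card ι + 1)) := by
          rw [Finset.sum_const, Finset.card_univ, nsmul_eq_mul]
          ring
      _ < ε := by
          refine mul_lt_of_lt_one_right hε ?_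
          rw [div_lt_one (by positivity)]
          linarith

end DensityMatrix

/-! ### The nonequilibrium free energy -/

namespace QObject

open Matrix

variable {β : ℝ}

/-- The equilibrium free energy is `-log Z / β`, with `Z` the partition function. -/
theorem freeEnergy_gibbs (hβ : β ≠ 0) (p : QObject) {κ : Type} [Fintype κ] [DecidableEq κ]
    {U : Matrix p.ι κ ℂ} {d : κ → ℝ} (h : Diagonalizes p.ham.mat U d) :
    (p.gibbs β).freeEnergy β = -(Real.log (∑ k, Real.exp (-β * d k)) / β) := by
  rw [← h.sum_eigenvalues p.ham.isHermitian fun x => Real.exp (-β * x)]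
  have hH := p.ham.isHermitian.diagonalizes
  set e := p.ham.isHermitian.eigenvalues
  set V := (p.ham.isHermitian.eigenvectorUnitary : Matrix p.ι p.ι ℂ)
  have hB : Diagonalizes (p.ham.boltzmann β) V fun k => Real.exp (-β * e k) := by
    have := (hH.smul (-β)).exp
    rwa [Complex.ofReal_neg] at this
  set Z := ∑ k, Real.exp (-β * e k) with hZ
  have hZpos : 0 < Z := Finset.sum_pos (fun k _ => Real.exp_pos _) Finset.univ_nonempty
  have hG : Diagonalizes (p.gibbs β).state.mat V fun k => Z⁻¹ * Real.exp (-β * e k) := by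
    have := hB.smul Z⁻¹
    rwa [Complex.ofReal_inv, ← hB.trace_eq] at this
  have hent : (p.gibbs β).entropy
      = β * (∑ k, Z⁻¹ * Real.exp (-β * e k) * e k) + Real.log Z := by
    have hterm : ∀ k, Real.negMulLog (Z⁻¹ * Real.exp (-β * e k))
        = β * (Z⁻¹ * Real.exp (-β * e k) * e k) + Z⁻¹ * Real.exp (-β * e k) * Real.log Z := by
      intro k
      rw [Real.negMulLog, Real.log_mul (inv_pos.2 hZpos).ne' (Real.exp_pos _).ne', Real.log_exp,
        Real.log_inv]
      ring
    rw [show (p.gibbs β).entropy = (p.gibbs β).state.entropy from rfl,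
      (p.gibbs β).state.entropy_eq hG, Finset.sum_congr rfl fun k _ => hterm k,
      Finset.sum_add_distrib, ← Finset.mul_sum, ← Finset.sum_mul, ← Finset.mul_sum, ← hZ,
      inv_mul_cancel₀ hZpos.ne', one_mul]
  have htr : ((p.gibbs β).state.mat * (p.gibbs β).ham.mat).trace.re
      = ∑ k, Z⁻¹ * Real.exp (-β * e k) * e k := by
    have h := congrArg Complex.re (hG.mul hH).trace_eq
    rwa [Complex.ofReal_re] at h
  rw [freeEnergy, hent, htr]
  field_simp
  ring

/-- `ΔF` in terms of any diagonalization of the Hamiltonian. -/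
theorem deltaF_eq (hβ : β ≠ 0) (p : QObject) {κ : Type} [Fintype κ] [DecidableEq κ]
    {U : Matrix p.ι κ ℂ} {d : κ → ℝ} (h : Diagonalizes p.ham.mat U d) :
    p.deltaF β = (p.state.mat * p.ham.mat).trace.re - p.state.entropy / β
      + Real.log (∑ k, Real.exp (-β * d k)) / β := by
  rw [deltaF, freeEnergy_gibbs hβ p h, freeEnergy, entropy]
  ring

theorem deltaF_nonneg (hβ : 0 < β) (p : QObject) : 0 ≤ p.deltaF β := by
  have hH := p.ham.isHermitian.diagonalizes
  rw [deltaF_eq hβ.ne' p hH]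
  have h := p.state.entropy_le_trace_add_log (hH.smul β)
  rw [Matrix.mul_smul, Matrix.trace_smul, smul_eq_mul, Complex.re_ofReal_mul] at h
  simp only [← neg_mul] at h
  have : (p.state.mat * p.ham.mat).trace.re - p.state.entropy / β
      + Real.log (∑ k, Real.exp (-β * p.ham.isHermitian.eigenvalues k)) / β
      = (β * (p.state.mat * p.ham.mat).trace.re
        + Real.log (∑ k, Real.exp (-β * p.ham.isHermitian.eigenvalues k))
        - p.state.entropy) / β := by
    field_simp
    ring
  rw [this]
  exact div_nonneg (by linarith) hβ.le

theorem deltaF_gibbs (p : QObject) : (p.gibbs β).deltaF β = 0 :=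
  sub_self _

/-- The free energy of a bipartite object exceeds that of its parts by its mutual information. -/
theorem deltaF_nonInteracting (hβ : β ≠ 0) {ι κ : Type} [Fintype ι] [DecidableEq ι] [Fintype κ]
    [DecidableEq κ] (ρ : DensityMatrix (ι × κ)) (H : Hamiltonian ι) (K : Hamiltonian κ) :
    deltaF β ⟨ι × κ, ρ, H.nonInteracting K⟩
      = deltaF β ⟨ι, ρ.marginalLeft, H⟩ + deltaF β ⟨κ, ρ.marginalRight, K⟩
        + (ρ.marginalLeft.entropy + ρ.marginalRight.entropy - ρ.entropy) / β := by
  have hH := H.isHermitian.diagonalizes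
  have hK := K.isHermitian.diagonalizes
  have hι := ρ.marginalLeft.nonempty_index
  have hκ := ρ.marginalRight.nonempty_index
  rw [deltaF_eq hβ ⟨ι × κ, ρ, H.nonInteracting K⟩ (hH.nonInteracting hK),
    deltaF_eq hβ ⟨ι, ρ.marginalLeft, H⟩ hH, deltaF_eq hβ ⟨κ, ρ.marginalRight, K⟩ hK]
  change (ρ.mat * (H.mat ⊗ₖ (1 : Matrix κ κ ℂ) + (1 : Matrix ι ι ℂ) ⊗ₖ K.mat)).trace.re - _ + _ = _
  rw [Matrix.mul_add, Matrix.trace_add, DensityMatrix.trace_mul_kronecker_one,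
    DensityMatrix.trace_mul_one_kronecker, Complex.add_re, Fintype.sum_prod_type]
  simp only [mul_add, Real.exp_add, ← Finset.mul_sum, ← Finset.sum_mul]
  rw [Real.log_mul (Finset.sum_pos (fun k _ => Real.exp_pos _) Finset.univ_nonempty).ne'
    (Finset.sum_pos (fun k _ => Real.exp_pos _) Finset.univ_nonempty).ne']
  ring

theorem deltaF_superadditive (hβ : 0 < β) {ι κ : Type} [Fintype ι] [DecidableEq ι] [Fintype κ]
    [DecidableEq κ] (ρ : DensityMatrix (ι × κ)) (H : Hamiltonian ι) (K : Hamiltonian κ) :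
    deltaF β ⟨ι, ρ.marginalLeft, H⟩ + deltaF β ⟨κ, ρ.marginalRight, K⟩
      ≤ deltaF β ⟨ι × κ, ρ, H.nonInteracting K⟩ := by
  rw [deltaF_nonInteracting hβ.ne']
  have := div_nonneg (sub_nonneg.2 ρ.entropy_le_marginals) hβ.le
  linarith

theorem deltaF_tensor (hβ : β ≠ 0) (p q : QObject) :
    (p.tensor q).deltaF β = p.deltaF β + q.deltaF β := by
  rw [tensor, deltaF_nonInteracting hβ, DensityMatrix.marginalLeft_tensor,
    DensityMatrix.marginalRight_tensor, DensityMatrix.entropy_tensor, sub_self, zero_div, add_zero]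

theorem deltaF_conj (hβ : β ≠ 0) {ι κ : Type} [Fintype ι] [DecidableEq ι] [Fintype κ]
    [DecidableEq κ] (U : Matrix κ ι ℂ) (hU : Uᴴ * U = 1) (hU' : U * Uᴴ = 1)
    (ρ : DensityMatrix ι) (H : Hamiltonian ι) :
    deltaF β ⟨κ, ρ.conj U hU, H.conj U⟩ = deltaF β ⟨ι, ρ, H⟩ := by
  have hH := H.isHermitian.diagonalizes
  rw [deltaF_eq hβ ⟨ι, ρ, H⟩ hH, deltaF_eq hβ ⟨κ, ρ.conj U hU, H.conj U⟩ (hH.conj hU hU')]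
  have htr : ((ρ.conj U hU).mat * (H.conj U).mat).trace = (ρ.mat * H.mat).trace := by
    change (U * ρ.mat * Uᴴ * (U * H.mat * Uᴴ)).trace = _
    rw [show U * ρ.mat * Uᴴ * (U * H.mat * Uᴴ) = U * (ρ.mat * (Uᴴ * U) * H.mat * Uᴴ) by
      simp only [Matrix.mul_assoc], hU, Matrix.mul_one, Matrix.trace_mul_comm U, Matrix.mul_assoc,
      hU, Matrix.mul_one]
  change ((ρ.conj U hU).mat * (H.conj U).mat).trace.re - (ρ.conj U hU).entropy / β + _ = _
  rw [htr, DensityMatrix.entropy_conj U hU hU']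

theorem deltaF_shift (hβ : β ≠ 0) {ι : Type} [Fintype ι] [DecidableEq ι] (c : ℝ)
    (ρ : DensityMatrix ι) (H : Hamiltonian ι) :
    deltaF β ⟨ι, ρ, H.shift c⟩ = deltaF β ⟨ι, ρ, H⟩ := by
  have hH := H.isHermitian.diagonalizes
  have hι := ρ.nonempty_index
  rw [deltaF_eq hβ ⟨ι, ρ, H⟩ hH, deltaF_eq hβ ⟨ι, ρ, H.shift c⟩ (hH.add (hH.one.smul c))]
  change (ρ.mat * (H.mat + (c : ℂ) • (1 : Matrix ι ι ℂ))).trace.re - _ + _ = _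
  rw [Matrix.mul_add, Matrix.trace_add, Matrix.mul_smul, Matrix.mul_one, Matrix.trace_smul,
    ρ.trace_eq_one]
  simp only [mul_one, mul_add, Real.exp_add, ← Finset.sum_mul]
  rw [Real.log_mul (Finset.sum_pos (fun k _ => Real.exp_pos _) Finset.univ_nonempty).ne'
    (Real.exp_pos _).ne', Real.log_exp]
  simp
  field_simp
  ring

end QObject

/-- The second law: `ΔF` does not increase under thermal operations. -/
theorem ThermalTransition.deltaF_le {β : ℝ} (hβ : 0 < β) {p q : QObject}
    (h : ThermalTransition β p q) : q.deltaF β ≤ p.deltaF β := by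
  induction h with
  | conj U hU hU' ρ H => exact (QObject.deltaF_conj hβ.ne' U hU hU' ρ H).le
  | shift c ρ H => exact (QObject.deltaF_shift hβ.ne' c ρ H).le
  | @addBath p κ _ _ _ H =>
    rw [QObject.deltaF_tensor hβ.ne']
    have : QObject.deltaF β ⟨κ, H.gibbs β, H⟩ = 0 :=
      QObject.deltaF_gibbs (⟨κ, H.gibbs β, H⟩ : QObject)
    rw [this, add_zero]
  | energyPreserving U hU ρ H hcomm =>
    have hU' : U * Uᴴ = 1 := mul_eq_one_comm.1 hU
    -- The unitary fixes `H`, so this is a change of frame.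
    have hH : H.conj U = H := by
      apply Hamiltonian.ext_mat
      change U * H.mat * Uᴴ = H.mat
      rw [hcomm.eq, Matrix.mul_assoc, hU', Matrix.mul_one]
    have := QObject.deltaF_conj hβ.ne' U hU hU' ρ H
    rw [hH] at this
    exact this.le
  | traceOut ρ H K =>
    have h1 := QObject.deltaF_superadditive hβ ρ H K
    have h2 := QObject.deltaF_nonneg hβ ⟨_, ρ.marginalRight, K⟩
    linarith
  | trans _ _ h1 h2 => exact h2.trans h1

/-- Since `ΔF` is additive, the contribution of a catalyst cancels. -/
theorem CatalyticTransition.deltaF_le {β : ℝ} (hβ : 0 < β) {p r : QObject}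
    (h : CatalyticTransition β p r) : r.deltaF β ≤ p.deltaF β := by
  obtain ⟨c, hc⟩ := h
  have := hc.deltaF_le hβ
  rw [QObject.deltaF_tensor hβ.ne', QObject.deltaF_tensor hβ.ne'] at this
  linarith

/-- Since `ΔF` is superadditive, correlations between fuel and device cannot outwit the second
law. -/
theorem CorrelatedReach.deltaF_le {β : ℝ} (hβ : 0 < β) {pM pA qM qA : QObject}
    (h : CorrelatedReach β pM pA qM qA) :
    qM.deltaF β + qA.deltaF β ≤ pM.deltaF β + pA.deltaF β := by
  obtain ⟨ρ, h1, h2, h⟩ := h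
  have h3 := h.deltaF_le hβ
  have h4 := QObject.deltaF_superadditive hβ ρ qM.ham qA.ham
  rw [QObject.deltaF_tensor hβ.ne'] at h3
  rw [h1, h2] at h4
  exact h4.trans h3

/-- On trivial Hamiltonians `ΔF` is the entropy deficit. -/
theorem deltaF_of_mem_trivialHamiltonian {β : ℝ} (hβ : β ≠ 0) {p : QObject}
    (hp : p ∈ trivialHamiltonian) : p.deltaF β = (Real.log p.dim - p.entropy) / β := by
  obtain ⟨c, hc⟩ := hp
  have h : Diagonalizes p.ham.mat (1 : Matrix p.ι p.ι ℂ) fun _ => c :=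
    ⟨by simp, by simp, by
      rw [hc, Matrix.conjTranspose_one, Matrix.one_mul, Matrix.mul_one, Matrix.smul_one_eq_diagonal]⟩
  have hcard : (Fintype.card p.ι : ℝ) ≠ 0 := by exact_mod_cast Fintype.card_ne_zero
  rw [QObject.deltaF_eq hβ p h, hc, Matrix.mul_smul, Matrix.mul_one, Matrix.trace_smul,
    p.state.trace_eq_one, Finset.sum_const, Finset.card_univ, nsmul_eq_mul,
    Real.log_mul hcard (Real.exp_pos _).ne', Real.log_exp, QObject.dim, QObject.entropy]
  simp
  field_simp
  ring

/-! ### Elementary thermal transitions -/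

theorem QObject.tensor_empty_state (p : QObject) (i j : p.ι) (k l : Unit) :
    (p.tensor QObject.empty).state.mat (i, k) (j, l) = p.state.mat i j := by
  change p.state.mat i j * (1 : Matrix Unit Unit ℂ) k l = p.state.mat i j
  rw [Matrix.one_apply_eq, mul_one]

theorem QObject.tensor_empty_ham (p : QObject) (i j : p.ι) (k l : Unit) :
    (p.tensor QObject.empty).ham.mat (i, k) (j, l) = p.ham.mat i j := by
  change p.ham.mat i j * (1 : Matrix Unit Unit ℂ) k l + (1 : Matrix p.ι p.ι ℂ) i j * 0
    = p.ham.mat i j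
  rw [Matrix.one_apply_eq, mul_one, mul_zero, add_zero]

namespace ThermalTransition

open Matrix

variable {β : ℝ}

/-- Objects that are unitarily equivalent up to a shift of the energy can be transformed into each
other by thermal operations; see also `of_unitary_symm`. -/
theorem of_unitary {p q : QObject} (U : Matrix q.ι p.ι ℂ) (hU : Uᴴ * U = 1) (hU' : U * Uᴴ = 1)
    (c : ℝ) (hs : q.state.mat = U * p.state.mat * Uᴴ)
    (hh : q.ham.mat = U * p.ham.mat * Uᴴ + (c : ℂ) • 1) : ThermalTransition β p q := by
  obtain ⟨ι, ρ, H⟩ := p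
  obtain ⟨κ, σ, K⟩ := q
  have hσ : ρ.conj (κ := κ) U hU = σ := DensityMatrix.ext_mat hs.symm
  have hK : (H.conj (κ := κ) U).shift c = K := Hamiltonian.ext_mat hh.symm
  have h := (ThermalTransition.conj (β := β) (κ := κ) U hU hU' ρ H).trans
    (ThermalTransition.shift c _ _)
  rwa [hσ, hK] at h

theorem of_unitary_symm {p q : QObject} (U : Matrix q.ι p.ι ℂ) (hU : Uᴴ * U = 1)
    (hU' : U * Uᴴ = 1) (c : ℝ) (hs : q.state.mat = U * p.state.mat * Uᴴ)
    (hh : q.ham.mat = U * p.ham.mat * Uᴴ + (c : ℂ) • 1) : ThermalTransition β q p := by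
  have hcancel : ∀ A : Matrix p.ι p.ι ℂ, Uᴴ * (U * A * Uᴴ) * U = A := fun A => by
    rw [show Uᴴ * (U * A * Uᴴ) * U = Uᴴ * U * A * (Uᴴ * U) by simp only [Matrix.mul_assoc], hU,
      Matrix.one_mul, Matrix.mul_one]
  refine of_unitary Uᴴ (by simpa using hU') (by simpa using hU) (-c) ?_ ?_
  · rw [hs, conjTranspose_conjTranspose, hcancel]
  · rw [hh, conjTranspose_conjTranspose, Matrix.mul_add, Matrix.add_mul, hcancel, Matrix.mul_smul,
      Matrix.smul_mul, Matrix.mul_one, hU, add_assoc, ← add_smul]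
    simp

/-- Relabelling the basis vectors is a thermal operation. -/
theorem of_equiv {p q : QObject} (e : p.ι ≃ q.ι)
    (hs : ∀ i j, q.state.mat (e i) (e j) = p.state.mat i j)
    (hh : ∀ i j, q.ham.mat (e i) (e j) = p.ham.mat i j) : ThermalTransition β p q := by
  set U : Matrix q.ι p.ι ℂ := Matrix.of fun k i => if e.symm k = i then 1 else 0
  have hconj : ∀ A : Matrix p.ι p.ι ℂ, U * A * Uᴴ = A.submatrix e.symm e.symm := fun A => by
    ext k l
    simp [U, Matrix.mul_apply]
  refine of_unitary U ?_ ?_ 0 ?_ ?_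
  · ext i j
    simp only [U, Matrix.mul_apply, Matrix.one_apply, conjTranspose_apply, of_apply, apply_ite star,
      star_one, star_zero, ite_mul, one_mul, zero_mul, ← ite_and]
    rw [Finset.sum_eq_single (e i) (fun k _ hk => if_neg fun h => hk (e.symm_apply_eq.1 h.1))
      (by simp)]
    simp
  · have := hconj 1
    rwa [Matrix.mul_one, Matrix.submatrix_one_equiv] at this
  · rw [hconj]
    ext k l
    simp [← hs]
  · rw [hconj]
    ext k l
    simp [← hh]

theorem tensor_comm (p q : QObject) : ThermalTransition β (p.tensor q) (q.tensor p) := by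
  refine of_equiv (Equiv.prodComm p.ι q.ι) ?_ ?_
  · rintro ⟨i, k⟩ ⟨j, l⟩
    exact mul_comm _ _
  · rintro ⟨i, k⟩ ⟨j, l⟩
    change (q.ham.nonInteracting p.ham).mat (k, i) (l, j)
      = (p.ham.nonInteracting q.ham).mat (i, k) (j, l)
    simp only [Hamiltonian.nonInteracting, Matrix.add_apply, kroneckerMap_apply]
    ring

theorem tensor_empty (p : QObject) : ThermalTransition β (p.tensor QObject.empty) p :=
  of_equiv (Equiv.prodPUnit p.ι) (fun x y => (p.tensor_empty_state x.1 y.1 x.2 y.2).symm)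
    fun x y => (p.tensor_empty_ham x.1 y.1 x.2 y.2).symm

theorem to_tensor_empty (p : QObject) : ThermalTransition β p (p.tensor QObject.empty) :=
  of_equiv (Equiv.prodPUnit p.ι).symm (fun i j => p.tensor_empty_state i j () ())
    fun i j => p.tensor_empty_ham i j () ()

theorem empty_tensor (p : QObject) : ThermalTransition β (QObject.empty.tensor p) p :=
  (tensor_comm _ _).trans (tensor_empty p)

theorem to_empty_tensor (p : QObject) : ThermalTransition β p (QObject.empty.tensor p) :=
  (to_tensor_empty p).trans (tensor_comm _ _)

/-- Every object can be discarded. -/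
theorem to_empty (p : QObject) : ThermalTransition β p QObject.empty := by
  refine (to_empty_tensor p).trans ?_
  have h := ThermalTransition.traceOut (β := β) (QObject.empty.state.tensor p.state)
    QObject.empty.ham p.ham
  rw [DensityMatrix.marginalLeft_tensor] at h
  exact h

/-- The empty object is a catalyst that does nothing. -/
theorem catalytic {p r : QObject} (h : ThermalTransition β p r) : CatalyticTransition β p r :=
  ⟨QObject.empty, (tensor_empty p).trans (h.trans (to_tensor_empty r))⟩

/-- An uncorrelated final state. -/
theorem correlatedReach {pM pA qM qA : QObject}
    (h : ThermalTransition β (pM.tensor pA) (qM.tensor qA)) : CorrelatedReach β pM pA qM qA :=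
  ⟨qM.state.tensor qA.state, DensityMatrix.marginalLeft_tensor _ _,
    DensityMatrix.marginalRight_tensor _ _, h.catalytic⟩

/-- Without fuel, a device can be split into fuel and a smaller device, which stay correlated. -/
theorem correlatedReach_split {ι κ : Type} [Fintype ι] [DecidableEq ι] [Fintype κ] [DecidableEq κ]
    (ρ : DensityMatrix (ι × κ)) (H : Hamiltonian ι) (K : Hamiltonian κ) :
    CorrelatedReach β QObject.empty ⟨ι × κ, ρ, H.nonInteracting K⟩
      ⟨ι, ρ.marginalLeft, H⟩ ⟨κ, ρ.marginalRight, K⟩ :=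
  ⟨ρ, rfl, rfl, (empty_tensor ⟨ι × κ, ρ, H.nonInteracting K⟩).catalytic⟩

end ThermalTransition

theorem tensor_mem_trivialHamiltonian {p q : QObject} (hp : p ∈ trivialHamiltonian)
    (hq : q ∈ trivialHamiltonian) : p.tensor q ∈ trivialHamiltonian := by
  obtain ⟨c, hc⟩ := hp
  obtain ⟨d, hd⟩ := hq
  refine ⟨c + d, ?_⟩
  change p.ham.mat ⊗ₖ (1 : Matrix q.ι q.ι ℂ) + (1 : Matrix p.ι p.ι ℂ) ⊗ₖ q.ham.mat = _
  rw [hc, hd, Matrix.smul_kronecker, Matrix.kronecker_smul, Matrix.one_kronecker_one, ← add_smul]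
  push_cast
  rfl

/-! ### Consequences of the axiom on correlated fuel cycles -/

section Axioms

variable {β : ℝ} {P : Set QObject} {W : P → P → ℝ}

theorem CorrelatedReach.le_corrWork {pM qM : QObject} {pA qA : P}
    (h : CorrelatedReach β pM pA qM qA) : (W pA qA : EReal) ≤ corrWork β P W pM qM :=
  le_iSup_of_le pA (le_iSup_of_le qA (le_iSup_of_le h le_rfl))

theorem CorrelatedCyclicFuelAxiom.work_nonpos (hW : CorrelatedCyclicFuelAxiom β P W) {pM : QObject}
    {pA qA : P} (h : CorrelatedReach β pM pA pM qA) : W pA qA ≤ 0 := by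
  have h1 := hW 1 (fun _ => pM) rfl
  rw [Finset.sum_range_one] at h1
  exact_mod_cast h.le_corrWork.trans h1

theorem CorrelatedCyclicFuelAxiom.work_add_nonpos (hW : CorrelatedCyclicFuelAxiom β P W)
    {pM qM : QObject} {pA qA pA' qA' : P} (h : CorrelatedReach β pM pA qM qA)
    (h' : CorrelatedReach β qM pA' pM qA') : W pA qA + W pA' qA' ≤ 0 := by
  have h1 := hW 2 (fun n => if n = 1 then qM else pM) rfl
  rw [Finset.sum_range_succ, Finset.sum_range_one] at h1
  have h2 := (add_le_add h.le_corrWork h'.le_corrWork).trans h1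
  exact_mod_cast h2

end Axioms

/-- The diagonal state with the given distribution of eigenvalues. -/
noncomputable def DensityMatrix.ofDistribution {ι : Type} [Fintype ι] [DecidableEq ι]
    (p : stdSimplex ℝ ι) : DensityMatrix ι :=
  ⟨Matrix.diagonal fun i => (p i : ℂ), Matrix.PosSemidef.diagonal fun i => by
    rw [Pi.zero_apply]
    exact Complex.zero_le_real.2 (stdSimplex.zero_le p i), by
    rw [Matrix.trace_diagonal]
    exact_mod_cast stdSimplex.sum_eq_one p⟩

open Classical in
/-- A classical device with vanishing Hamiltonian: its state is diagonal. -/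
noncomputable def classicalDevice (ι : Type) [Fintype ι] (p : stdSimplex ℝ ι) :
    trivialHamiltonian :=
  ⟨⟨ι, DensityMatrix.ofDistribution p, ⟨0, Matrix.isHermitian_zero⟩⟩, 0, by
    rw [Complex.ofReal_zero, zero_smul]⟩

theorem classicalDevice_state_apply {ι : Type} [Fintype ι] [DecidableEq ι] (p : stdSimplex ℝ ι)
    (i j : ι) : (classicalDevice ι p).1.state.mat i j = if i = j then (p i : ℂ) else 0 := by
  simp only [classicalDevice, DensityMatrix.ofDistribution, Matrix.diagonal_apply]
  congr

theorem classicalDevice_ham {ι : Type} [Fintype ι] (p : stdSimplex ℝ ι) :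
    (classicalDevice ι p).1.ham.mat = 0 := rfl

/-! ### The potential on classical devices is a measure of nonuniformity -/

namespace IsContinuousPotential

open Matrix

variable {β : ℝ} {W : trivialHamiltonian → trivialHamiltonian → ℝ} {M : trivialHamiltonian → ℝ}

/-- A cycle of the empty fuel: free transitions of the device do not increase `M`. -/
theorem le_of_transition (hM : IsContinuousPotential W M)
    (hW : CorrelatedCyclicFuelAxiom β trivialHamiltonian W) {p q : trivialHamiltonian}
    (h : ThermalTransition β p.1 q.1) : M q ≤ M p := by
  have h1 : CorrelatedReach β QObject.empty p.1 QObject.empty q.1 :=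
    ((ThermalTransition.empty_tensor p.1).trans
      (h.trans (ThermalTransition.to_empty_tensor q.1))).correlatedReach
  have h2 := hW.work_nonpos h1
  rw [hM.2.2] at h2
  linarith

theorem eq_of_equiv (hM : IsContinuousPotential W M)
    (hW : CorrelatedCyclicFuelAxiom β trivialHamiltonian W) {p q : trivialHamiltonian}
    (e : p.1.ι ≃ q.1.ι) (hs : ∀ i j, q.1.state.mat (e i) (e j) = p.1.state.mat i j)
    (hh : ∀ i j, q.1.ham.mat (e i) (e j) = p.1.ham.mat i j) : M q = M p :=
  le_antisymm (hM.le_of_transition hW (ThermalTransition.of_equiv e hs hh))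
    (hM.le_of_transition hW (ThermalTransition.of_equiv e.symm
      (fun i j => by rw [← hs, e.apply_symm_apply, e.apply_symm_apply])
      (fun i j => by rw [← hh, e.apply_symm_apply, e.apply_symm_apply])))

theorem nonneg (hM : IsContinuousPotential W M)
    (hW : CorrelatedCyclicFuelAxiom β trivialHamiltonian W) (p : trivialHamiltonian) : 0 ≤ M p := by
  rw [← hM.1]
  exact hM.le_of_transition hW (q := emptyDevice) (ThermalTransition.to_empty p.1)

/-- Exchanging `p` between the fuel and the device in both directions makes `M` subadditive. -/
theorem tensor_le (hM : IsContinuousPotential W M)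
    (hW : CorrelatedCyclicFuelAxiom β trivialHamiltonian W) (p q r : trivialHamiltonian)
    (hr : r.1 = p.1.tensor q.1) : M r ≤ M p + M q := by
  have h1 : CorrelatedReach β QObject.empty p.1 p.1 emptyDevice.1 :=
    (ThermalTransition.tensor_comm QObject.empty p.1).correlatedReach
  have h2 : CorrelatedReach β p.1 q.1 QObject.empty r.1 :=
    ((ThermalTransition.to_empty_tensor (p.1.tensor q.1)).trans (hr ▸ .of_equiv (Equiv.refl _)
      (fun _ _ => rfl) fun _ _ => rfl)).correlatedReach
  have h := hW.work_add_nonpos h1 h2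
  rw [hM.2.2, hM.2.2, hM.1] at h
  linarith

/-- Moving one part of a correlated device into the fuel and returning it afterwards, without its
correlations, makes `M` superadditive. -/
theorem superadditive (hM : IsContinuousPotential W M)
    (hW : CorrelatedCyclicFuelAxiom β trivialHamiltonian W) {ι κ : Type} [Fintype ι]
    [DecidableEq ι] [Fintype κ] [DecidableEq κ] (ρ : DensityMatrix (ι × κ)) (H : Hamiltonian ι)
    (K : Hamiltonian κ) (p q r : trivialHamiltonian) (hp : p.1 = ⟨ι, ρ.marginalLeft, H⟩)
    (hq : q.1 = ⟨κ, ρ.marginalRight, K⟩) (hr : r.1 = ⟨ι × κ, ρ, H.nonInteracting K⟩) :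
    M p + M q ≤ M r := by
  have h1 : CorrelatedReach β QObject.empty r.1 p.1 q.1 := by
    rw [hp, hq, hr]
    exact ThermalTransition.correlatedReach_split ρ H K
  have h2 : CorrelatedReach β p.1 emptyDevice.1 QObject.empty p.1 :=
    (ThermalTransition.tensor_comm p.1 QObject.empty).correlatedReach
  have h := hW.work_add_nonpos h1 h2
  rw [hM.2.2, hM.2.2, hM.1] at h
  linarith

/-- Classical devices may be represented by any device with the same diagonal state. -/
theorem eq_classicalDevice_of_equiv (hM : IsContinuousPotential W M)
    (hW : CorrelatedCyclicFuelAxiom β trivialHamiltonian W) {κ : Type} [Fintype κ] [DecidableEq κ]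
    (r : stdSimplex ℝ κ) (p : trivialHamiltonian) (e : κ ≃ p.1.ι)
    (hs : ∀ i j, p.1.state.mat (e i) (e j) = if i = j then (r i : ℂ) else 0)
    (hh : p.1.ham.mat = 0) : M p = M (classicalDevice κ r) :=
  hM.eq_of_equiv hW (p := classicalDevice κ r) e
    (fun i j => (hs i j).trans (classicalDevice_state_apply r i j).symm)
    fun i j => congrFun (congrFun hh (e i)) (e j)

theorem isNonuniformity (hM : IsContinuousPotential W M)
    (hW : CorrelatedCyclicFuelAxiom β trivialHamiltonian W) :
    IsNonuniformity fun ι _ p => M (classicalDevice ι p) where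
  nonneg p := hM.nonneg hW _
  map_equiv {ι κ} _ _ e p := by
    classical
    refine hM.eq_classicalDevice_of_equiv hW p (classicalDevice κ _) e (fun i j => ?_) rfl
    refine (classicalDevice_state_apply (stdSimplex.map e p) (e i) (e j)).trans ?_
    rw [stdSimplex.map_equiv_apply]
    simp
  superadditive {ι κ} _ _ r := by
    classical
    let ρ : DensityMatrix (ι × κ) := DensityMatrix.ofDistribution r
    let H : Hamiltonian ι := ⟨0, Matrix.isHermitian_zero⟩
    let K : Hamiltonian κ := ⟨0, Matrix.isHermitian_zero⟩
    have hHK : (H.nonInteracting K).mat = 0 := by simp [H, K, Hamiltonian.nonInteracting]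
    let p : trivialHamiltonian := ⟨⟨ι, ρ.marginalLeft, H⟩, 0, by simp [H]⟩
    let q : trivialHamiltonian := ⟨⟨κ, ρ.marginalRight, K⟩, 0, by simp [K]⟩
    let s : trivialHamiltonian := ⟨⟨ι × κ, ρ, H.nonInteracting K⟩, 0, by simp [hHK]⟩
    have hp : M p = M (classicalDevice ι (stdSimplex.map Prod.fst r)) := by
      refine hM.eq_classicalDevice_of_equiv hW _ p (Equiv.refl ι) (fun i j => ?_) rfl
      change ∑ k, Matrix.diagonal (fun x => (r x : ℂ)) (i, k) (j, k) = _
      rw [stdSimplex.map_apply, Finset.sum_filter, Fintype.sum_prod_type]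
      by_cases hij : i = j
      · subst hij
        rw [Finset.sum_eq_single i (fun x _ hx => by simp [hx]) (by simp)]
        simp
      · simp [hij]
    have hq : M q = M (classicalDevice κ (stdSimplex.map Prod.snd r)) := by
      refine hM.eq_classicalDevice_of_equiv hW _ q (Equiv.refl κ) (fun i j => ?_) rfl
      change ∑ k, Matrix.diagonal (fun x => (r x : ℂ)) (k, i) (k, j) = _
      rw [stdSimplex.map_apply, Finset.sum_filter, Fintype.sum_prod_type_right]
      by_cases hij : i = j
      · subst hij
        rw [Finset.sum_eq_single i (fun x _ hx => by simp [hx]) (by simp)]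
        simp
      · simp [hij]
    have hs : M s = M (classicalDevice (ι × κ) r) :=
      hM.eq_classicalDevice_of_equiv hW r s (Equiv.refl _) (fun i j => Matrix.diagonal_apply _ _ _)
        hHK
    rw [← hp, ← hq, ← hs]
    exact hM.superadditive hW ρ H K p q s rfl rfl rfl
  prod {ι κ} _ _ p q := by
    classical
    let P := classicalDevice ι p
    let Q := classicalDevice κ q
    let R : trivialHamiltonian := ⟨P.1.tensor Q.1, tensor_mem_trivialHamiltonian P.2 Q.2⟩
    have hR : M R = M (classicalDevice (ι × κ) (stdSimplex.prod p q)) := by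
      refine hM.eq_classicalDevice_of_equiv hW _ R (Equiv.refl _) ?_ ?_
      · rintro ⟨i, k⟩ ⟨j, l⟩
        change P.1.state.mat i j * Q.1.state.mat k l = _
        refine (congrArg₂ (· * ·) (classicalDevice_state_apply p i j)
          (classicalDevice_state_apply q k l)).trans ?_
        rw [stdSimplex.prod_apply]
        by_cases h1 : i = j <;> by_cases h2 : k = l <;> simp [h1, h2]
      · change (P.1.ham.nonInteracting Q.1.ham).mat = 0
        simp [Hamiltonian.nonInteracting, P, Q, classicalDevice_ham]
    rw [← hR]
    refine le_antisymm (hM.tensor_le hW P Q R rfl) ?_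
    refine hM.superadditive hW (P.1.state.tensor Q.1.state) P.1.ham Q.1.ham P Q R ?_ ?_ rfl
    · rw [DensityMatrix.marginalLeft_tensor]
    · rw [DensityMatrix.marginalRight_tensor]
  uniform {ι} _ _ := by
    classical
    refine le_antisymm ?_ (hM.nonneg hW _)
    let H : Hamiltonian ι := ⟨0, Matrix.isHermitian_zero⟩
    have hB : H.boltzmann β = 1 := by simp [Hamiltonian.boltzmann, H]
    let G : trivialHamiltonian := ⟨⟨ι, H.gibbs β, H⟩, 0, by simp [H]⟩
    have hG : M G = M (classicalDevice ι stdSimplex.barycenter) := by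
      refine hM.eq_classicalDevice_of_equiv hW _ G (Equiv.refl _) (fun i j => ?_) rfl
      change ((H.boltzmann β).trace⁻¹ • H.boltzmann β) i j = _
      rw [hB, stdSimplex.coe_barycenter_apply, Matrix.trace_one, Matrix.smul_apply,
        Matrix.one_apply]
      split_ifs <;> simp
    rw [← hG, ← hM.1]
    exact hM.le_of_transition hW (p := emptyDevice) (q := G)
      ((ThermalTransition.addBath QObject.empty H).trans (ThermalTransition.empty_tensor _))
  continuous ι _ := by
    classical
    have hc := hM.2.1 ι ⟨0, Matrix.isHermitian_zero⟩
    have hmem : ∀ ρ : DensityMatrix ι,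
        (⟨ι, ρ, ⟨0, Matrix.isHermitian_zero⟩⟩ : QObject) ∈ trivialHamiltonian := fun ρ =>
      ⟨0, by simp⟩
    have hd : Continuous (DensityMatrix.ofDistribution : stdSimplex ℝ ι → DensityMatrix ι) := by
      rw [continuous_induced_rng]
      exact Continuous.matrix_diagonal (continuous_pi fun i => Complex.continuous_ofReal.comp
        ((continuous_apply i).comp continuous_subtype_val))
    have h := hc.comp (hd.subtype_mk fun p => hmem _)
    convert h using 1
    funext p
    symm
    exact hM.eq_classicalDevice_of_equiv hW p ⟨_, hmem (DensityMatrix.ofDistribution p)⟩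
      (Equiv.refl ι) (fun i j => Matrix.diagonal_apply _ _ _) rfl

/-- The potential of a device depends only on the eigenvalues of its state. -/
theorem eq_classicalDevice (hM : IsContinuousPotential W M)
    (hW : CorrelatedCyclicFuelAxiom β trivialHamiltonian W) (p : trivialHamiltonian) :
    ∃ r : stdSimplex ℝ p.1.ι, stdSimplex.shannon r = p.1.entropy ∧
      M p = M (classicalDevice p.1.ι r) := by
  have hρ := p.1.state.posSemidef.isHermitian.diagonalizes
  let r : stdSimplex ℝ p.1.ι := ⟨p.1.state.posSemidef.isHermitian.eigenvalues,
    p.1.state.posSemidef.eigenvalues_nonneg, p.1.state.sum_eigenvalues⟩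
  obtain ⟨c, hc⟩ := p.2
  let q : trivialHamiltonian :=
    ⟨⟨p.1.ι, DensityMatrix.ofDistribution r, ⟨0, Matrix.isHermitian_zero⟩⟩, 0, by simp⟩
  have hq : M q = M (classicalDevice p.1.ι r) :=
    hM.eq_classicalDevice_of_equiv hW r q (Equiv.refl _) (fun i j => Matrix.diagonal_apply _ _ _)
      rfl
  have hham : p.1.ham.mat
      = (p.1.state.posSemidef.isHermitian.eigenvectorUnitary : Matrix p.1.ι p.1.ι ℂ) * 0
        * (p.1.state.posSemidef.isHermitian.eigenvectorUnitary : Matrix p.1.ι p.1.ι ℂ)ᴴ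
        + (c : ℂ) • 1 := by
    rw [hc, Matrix.mul_zero, Matrix.zero_mul, zero_add]
  refine ⟨r, rfl, hq ▸ le_antisymm ?_ ?_⟩
  · exact hM.le_of_transition hW (p := q) (ThermalTransition.of_unitary _ hρ.conjTranspose_mul
      hρ.mul_conjTranspose c hρ.eq hham)
  · exact hM.le_of_transition hW (q := q) (ThermalTransition.of_unitary_symm _
      hρ.conjTranspose_mul hρ.mul_conjTranspose c hρ.eq hham)

/-- A continuous potential is a multiple of the entropy deficit; the factor is the value of a pure
bit divided by `log 2`. -/
theorem eq_mul_entropy_deficit (hM : IsContinuousPotential W M)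
    (hW : CorrelatedCyclicFuelAxiom β trivialHamiltonian W) :
    ∃ a : ℝ, 0 ≤ a ∧ ∀ p : trivialHamiltonian, M p = a * (Real.log p.1.dim - p.1.entropy) := by
  refine ⟨_, div_nonneg ((hM.isNonuniformity hW).nonneg (stdSimplex.vertex (0 : Fin 2)))
    (Real.log_nonneg one_le_two), fun p => ?_⟩
  obtain ⟨r, hr, h⟩ := hM.eq_classicalDevice hW p
  rw [h, ← hr]
  exact (hM.isNonuniformity hW).eq_mul r

end IsContinuousPotential

/-! ### Free-energy differences satisfy the axioms -/

theorem corrWork_le {β a : ℝ} (hβ : 0 < β) (ha : 0 ≤ a) {P : Set QObject} {W : P → P → ℝ}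
    (hW : ∀ p q, W p q = a * (q.1.deltaF β - p.1.deltaF β)) (pM qM : QObject) :
    corrWork β P W pM qM ≤ ((a * (pM.deltaF β - qM.deltaF β) : ℝ) : EReal) := by
  refine iSup_le fun pA => iSup_le fun qA => iSup_le fun h => ?_
  rw [hW, EReal.coe_le_coe_iff]
  have := h.deltaF_le hβ
  exact mul_le_mul_of_nonneg_left (by linarith) ha

theorem correlatedCyclicFuelAxiom_of_deltaF {β a : ℝ} (hβ : 0 < β) (ha : 0 ≤ a) {P : Set QObject}
    {W : P → P → ℝ} (hW : ∀ p q, W p q = a * (q.1.deltaF β - p.1.deltaF β)) :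
    CorrelatedCyclicFuelAxiom β P W := by
  intro n p hp
  have hle : ∀ n : ℕ, ∑ i ∈ Finset.range n, corrWork β P W (p i) (p (i + 1))
      ≤ ((a * ((p 0).deltaF β - (p n).deltaF β) : ℝ) : EReal) := by
    intro n
    induction n with
    | zero => simp
    | succ n ih =>
      rw [Finset.sum_range_succ]
      refine (add_le_add ih (corrWork_le hβ ha hW _ _)).trans_eq ?_
      rw [← EReal.coe_add]
      congr 1
      ring
  simpa [hp] using hle n

theorem cyclicDeviceAxiom_of_deltaF {β a : ℝ} {P : Set QObject}
    {W : P → P → ℝ} (hW : ∀ p q, W p q = a * (q.1.deltaF β - p.1.deltaF β)) :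
    CyclicDeviceAxiom P W := by
  intro n p hp
  simp only [hW]
  rw [← Finset.mul_sum, Finset.sum_range_sub fun i => (p i).1.deltaF β, hp, sub_self, mul_zero]

theorem continuousInState_deltaF {β : ℝ} (hβ : β ≠ 0) :
    ContinuousInState trivialHamiltonian fun p => p.1.deltaF β := by
  intro ι _ _ H
  have h : (fun ρ : {ρ : DensityMatrix ι // (⟨ι, ρ, H⟩ : QObject) ∈ trivialHamiltonian} =>
      QObject.deltaF β ⟨ι, ρ.1, H⟩) = fun ρ => (Real.log (Fintype.card ι) - ρ.1.entropy) / β :=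
    funext fun ρ => deltaF_of_mem_trivialHamiltonian hβ ρ.2
  change Continuous fun ρ : {ρ : DensityMatrix ι // (⟨ι, ρ, H⟩ : QObject) ∈ trivialHamiltonian} =>
    QObject.deltaF β ⟨ι, ρ.1, H⟩
  rw [h]
  exact (continuous_const.sub
    (DensityMatrix.continuous_entropy.comp continuous_subtype_val)).div_const β

theorem mainTheorem5 (β : ℝ) (hβ : 0 < β)
    (W : trivialHamiltonian → trivialHamiltonian → ℝ) :
    ((CyclicDeviceAxiom trivialHamiltonian W ∧
        CorrelatedCyclicFuelAxiom β trivialHamiltonian W ∧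
        ∃ M : trivialHamiltonian → ℝ, IsContinuousPotential W M) ↔
      ∃ a : ℝ, 0 ≤ a ∧ ∀ p q : trivialHamiltonian,
        W p q = a * (q.1.deltaF β - p.1.deltaF β)) ∧
    (CyclicDeviceAxiom trivialHamiltonian W →
      CorrelatedCyclicFuelAxiom β trivialHamiltonian W →
      ∀ M : trivialHamiltonian → ℝ, IsContinuousPotential W M →
        ∃ a : ℝ, 0 ≤ a ∧ ∀ p : trivialHamiltonian,
          M p = a * (Real.log p.1.dim - p.1.entropy)) ∧
    ∀ p : trivialHamiltonian, p.1.deltaF β = (Real.log p.1.dim - p.1.entropy) / β := by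
  have hF : ∀ p : trivialHamiltonian, p.1.deltaF β = (Real.log p.1.dim - p.1.entropy) / β :=
    fun p => deltaF_of_mem_trivialHamiltonian hβ.ne' p.2
  refine ⟨⟨?_, ?_⟩, fun _ hW M hM => hM.eq_mul_entropy_deficit hW, hF⟩
  · rintro ⟨-, hW, M, hM⟩
    obtain ⟨a, ha, h⟩ := hM.eq_mul_entropy_deficit hW
    refine ⟨a * β, mul_nonneg ha hβ.le, fun p q => ?_⟩
    rw [hM.2.2, h, h, hF, hF]
    field_simp
  · rintro ⟨a, ha, hW⟩
    refine ⟨cyclicDeviceAxiom_of_deltaF hW, correlatedCyclicFuelAxiom_of_deltaF hβ ha hW,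
      fun p => a * (p.1.deltaF β - emptyDevice.1.deltaF β), by simp, fun ι _ _ H => ?_,
      fun p q => by rw [hW]; ring⟩
    exact continuous_const.mul ((continuousInState_deltaF hβ.ne' ι H).sub continuous_const)
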